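/- Let $\log$ be the logarithm to base $2$. Let $\mathrm{d}_{TV}(p,q)=\tfrac12\sum_{x}|p(x)-q(x)|$ for probability distributions $p,q$ on $[k]=\{1,\dots,k\}$. \emph{Tests.} For a reference distribution $q$ on $[k]$, an $(N,\varepsilon,\delta)$-test is a randomized map $e\colon[k]^N\to\{0,1\}$ such that, for $X_1,\dots,X_N$ independent with law $p$, $\Pr[e(X_1,\dots,X_N)=1]>1-\delta$ if $p=q$, and $\Pr[e(X_1,\dots,X_N)=0]>1-\delta$ for every $p$ with $\mathrm{d}_{TV}(p,q)>\varepsilon$. \emph{Protocols.} In an $\ell$-bit private-coin protocol with $n$ players, player $i$ observes one sample $X_i$, where $X_1,\dots,X_n$ are independent with law $p$, and sends a message $M_i\in\{0,1\}^\ell$, which depends on $X_i$ and on the player's own independent private coin. The referee sees only $M_1,\dots,M_n$ and outputs a bit by a (possibly randomized) rule. The protocol is deterministic if each $M_i$ is a function of $X_i$ alone. It is a $(k,\varepsilon,\delta)$-identity testing protocol for $q$ if the output is $1$ with probability $>1-\delta$ when $p=q$, and $0$ with probability $>1-\delta$ for every $p$ with $\mathrm{d}_{TV}(p,q)>\varepsilon$.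 \emph{Simulate-and-infer.} Put $m=\lceil k/(2^\ell-1)\rceil$. Cut $[k]$ into contiguous parts $S_1,\dots,S_m$, all of size $2^\ell-1$ except possibly the last, and encode the elements $i$ of each part $S_j$ by distinct nonzero sequences $s_i\in\{0,1\}^\ell$. The players are divided into $B$ blocks of $4m$ players. In each block, the players $2j-1$, $2j$, $2(j+m)-1$, $2(j+m)$ ($1\le j\le m$) send $s_x$ if their observation $x$ lies in $S_j$, and $\mathbf 0$ otherwise. The referee independently replaces each message by $\mathbf 0$ with probability $1/2$. If exactly one odd-numbered player of the block now has a nonzero message, and the message of the next (even-numbered) player is $\mathbf 0$, then the block returns the symbol $i\in S_j$ encoded by the nonzero message, where $S_j$ is the part assigned to that player; otherwise the block aborts. If at least $N$ blocks do not abort, the referee applies a centralized decision rule $e$ for $N$ samples to the first $N$ returned symbols, and otherwise outputs an arbitrary fixed bit. The number of players is $n=4Bm$. \textbf{Statement.} There is an absolute constant $C$ such that, for all integers $k,\ell$ with $1\le\ell\le\lceil\log k\rceil$, all $\varepsilon>0$ and all $\delta\in(0,1]$, there are $B$ and $N$ with $$n=4B\left\lceil\frac{k}{2^\ell-1}\right\rceil\le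 C\cdot\frac{k}{2^\ell\varepsilon^2}\left(\sqrt{k\log(1/\delta)}+\log(1/\delta)\right)$$ and such that, for every reference distribution $q$ on $[k]$, there is an $(N,\varepsilon,\delta)$-test $e$ for $q$ for which simulate-and-infer (with $B$ blocks, the rule $e$, and any fixed bit in the case of too few samples) is an $\ell$-bit deterministic private-coin $(k,\varepsilon,\delta)$-identity testing protocol for $q$. In particular, for every $\delta\in(0,1]$ there is a constant $C_\delta$ such that, for all $k,\ell,\varepsilon$ as above, the same holds with $n\le C_\delta\,k^{3/2}/(2^\ell\varepsilon^2)$. -/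

import Mathlib

noncomputable section

open scoped Classical in
/-- The law of independent random variables `Y i ∼ P i`, `i : ι`, with values in a finite set. -/
def indepLaw {ι α : Type} [Fintype ι] [Fintype α] (P : ι → PMF α) : PMF (ι → α) :=
  PMF.ofFintype (fun f => ∏ i, P i (f i)) (by
    have h := Finset.prod_univ_sum (fun _ : ι => (Finset.univ : Finset α)) (fun i a => P i a)
    rw [Fintype.piFinset_univ] at h
    rw [← h]
    refine Finset.prod_eq_one fun i _ => ?_
    exact (tsum_fintype _).symm.trans (P i).tsum_coe)

/-- The law of independent samples from `p`, one for each element of `ι`. -/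
def iidLaw {α : Type} [Fintype α] (p : PMF α) (ι : Type) [Fintype ι] : PMF (ι → α) :=
  indepLaw fun _ : ι => p

/-- Total variation distance: half of the `ℓ₁` distance. -/
def tvDist {k : ℕ} (p q : PMF (Fin k)) : ℝ :=
  (1 / 2) * ∑ x, |(p x).toReal - (q x).toReal|

/-- Messages of `ℓ` bits. -/
abbrev Message (ℓ : ℕ) : Type := Fin ℓ → Bool

/-- The all-zero message. -/
def zeroMessage (ℓ : ℕ) : Message ℓ := fun _ => false

/-! ### Centralized identity testing -/

/-- A randomized map `e` from `N` samples to `{0, 1}` (`true` is `1`, i.e. "accept") is an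
`(N, ε, δ)`-test for the reference distribution `q`. -/
def IsIdentityTest {k N : ℕ} (q : PMF (Fin k)) (ε δ : ℝ)
    (e : (Fin N → Fin k) → PMF Bool) : Prop :=
  1 - δ < (((iidLaw q (Fin N)).bind e) true).toReal ∧
    ∀ p : PMF (Fin k), ε < tvDist p q →
      1 - δ < (((iidLaw p (Fin N)).bind e) false).toReal

/-! ### Private-coin protocols -/

/-- An `ℓ`-bit private-coin simultaneous-message protocol with set of players `ι` and samples
in `Fin k`: player `i` draws a private coin, uses it to select a channel from samples to
`ℓ`-bit messages, and passes the sample through that channel. -/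
structure PrivateCoinSMP (ι : Type) (k ℓ : ℕ) where
  /-- The space of coins of each player. -/
  Coin : ι → Type
  /-- The law of the coin of each player. -/
  coinLaw : ∀ i, PMF (Coin i)
  /-- The channel which each player selects. -/
  channel : ∀ i, Coin i → Fin k → PMF (Message ℓ)

namespace PrivateCoinSMP

variable {ι : Type} {k ℓ : ℕ}

/-- The message of every player is a function of that player's sample. -/
def IsDeterministic (π : PrivateCoinSMP ι k ℓ) : Prop :=
  ∀ i, ∃ f : Fin k → Message ℓ,
    ∀ u ∈ (π.coinLaw i).support, ∀ x, π.channel i u x = PMF.pure (f x)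

/-- The law of all the messages, given the samples of the players; coins are independent. -/
def messagesGiven [Fintype ι] (π : PrivateCoinSMP ι k ℓ) (X : ι → Fin k) :
    PMF (ι → Message ℓ) :=
  indepLaw fun i => (π.coinLaw i).bind fun u => π.channel i u (X i)

/-- The law of all the messages when the samples are independent with law `p`. -/
def messages [Fintype ι] (π : PrivateCoinSMP ι k ℓ) (p : PMF (Fin k)) : PMF (ι → Message ℓ) :=
  (iidLaw p ι).bind π.messagesGiven

end PrivateCoinSMP

/-- An `ℓ`-bit private-coin distributed protocol with decisions in `{0, 1}`: a private-coin
protocol for the players together with a randomized decision rule of the referee, who sees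
only the messages. -/
structure PrivateCoinTester (ι : Type) (k ℓ : ℕ) where
  /-- The communication protocol of the players. -/
  comm : PrivateCoinSMP ι k ℓ
  /-- The randomized decision rule of the referee. -/
  referee : (ι → Message ℓ) → PMF Bool

namespace PrivateCoinTester

variable {ι : Type} [Fintype ι] {k ℓ : ℕ}

/-- The law of the decision when the samples of the players are independent with law `p`. -/
def output (P : PrivateCoinTester ι k ℓ) (p : PMF (Fin k)) : PMF Bool :=
  (P.comm.messages p).bind P.referee

/-- `P` is a `(k, ε, δ)`-identity testing protocol for the reference distribution `q`. -/
def IsIdentityTester (P : PrivateCoinTester ι k ℓ) (q : PMF (Fin k)) (ε δ : ℝ) : Prop :=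
  1 - δ < (P.output q true).toReal ∧
    ∀ p : PMF (Fin k), ε < tvDist p q → 1 - δ < (P.output p false).toReal

end PrivateCoinTester

/-! ### The simulation block

The domain `Fin k` is cut into `m = ⌈k / (2 ^ ℓ - 1)⌉` contiguous parts, all of size `2 ^ ℓ - 1`
except possibly the last one. A block has `4 * m` players; they are indexed by triples
`(h, j, c)`, where `j` is the part which the player watches. With the numbering `1, …, 4 * m`,
the triples `(0, j, 0)`, `(0, j, 1)`, `(1, j, 0)`, `(1, j, 1)` stand for the players
`2 * j - 1`, `2 * j`, `2 * (j + m) - 1`, `2 * (j + m)` for `j = 1, …, m`. -/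

/-- The number of parts of the domain. -/
def numParts (k ℓ : ℕ) : ℕ := k ⌈/⌉ (2 ^ ℓ - 1)

/-- The players of one block. -/
abbrev BlockPlayer (k ℓ : ℕ) : Type := Fin 2 × Fin (numParts k ℓ) × Fin 2

/-- The symbol `x` lies in the `j`-th part of the domain. -/
def InPart {k : ℕ} (ℓ : ℕ) (x : Fin k) (j : Fin (numParts k ℓ)) : Prop :=
  (x : ℕ) / (2 ^ ℓ - 1) = (j : ℕ)

/-- The nonzero `ℓ`-bit sequence of a symbol: the binary expansion of one plus the position of
the symbol in its part. -/
def symbolCode {k : ℕ} (ℓ : ℕ) (x : Fin k) : Message ℓ :=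
  fun b => Nat.testBit ((x : ℕ) % (2 ^ ℓ - 1) + 1) b

open scoped Classical in
/-- The message of a player who watches the part `j` and observes `x`. -/
def playerMessage {k : ℕ} (ℓ : ℕ) (j : Fin (numParts k ℓ)) (x : Fin k) : Message ℓ :=
  if InPart ℓ x j then symbolCode ℓ x else zeroMessage ℓ

/-- The referee changes a message to the zero message with probability `1 / 2`. -/
def flipMessage {ℓ : ℕ} (w : Message ℓ) : PMF (Message ℓ) :=
  (PMF.uniformOfFintype Bool).map fun c => if c then w else zeroMessage ℓ

/-- The flipped messages `w` of a block produce the symbol `x`: among the messages of the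
players `(h, j, 0)` exactly one is nonzero, it is the sequence of the symbol `x` of the
part `j`, and the message of the companion player `(h, j, 1)` is zero. -/
def Produces {k ℓ : ℕ} (w : BlockPlayer k ℓ → Message ℓ) (x : Fin k) : Prop :=
  ∃ (h : Fin 2) (j : Fin (numParts k ℓ)),
    (∀ h' j', w (h', j', 0) ≠ zeroMessage ℓ ↔ h' = h ∧ j' = j) ∧
      w (h, j, 1) = zeroMessage ℓ ∧ InPart ℓ x j ∧ w (h, j, 0) = symbolCode ℓ x

open scoped Classical in
/-- The outcome of a block: the symbol which the flipped messages produce (there is at most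
one), or `none` (abort). -/
def blockOutcome {k ℓ : ℕ} (w : BlockPlayer k ℓ → Message ℓ) : Option (Fin k) :=
  if h : ∃ x, Produces w x then some h.choose else none

/-! ### Simulate-and-infer -/

/-- The players of simulate-and-infer: `B` blocks of `4 * ⌈k / (2 ^ ℓ - 1)⌉` players each. -/
abbrev SIPlayer (k ℓ B : ℕ) : Type := Fin B × BlockPlayer k ℓ

/-- The symbols produced by the blocks which do not abort, in the order of the blocks. -/
def simulatedSamples {k ℓ B : ℕ} (w : SIPlayer k ℓ B → Message ℓ) : List (Fin k) :=
  (List.ofFn fun b : Fin B => blockOutcome fun t => w (b, t)).reduceOption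

/-- The decision from the flipped messages: if at least `N` blocks do not abort, then apply the
centralized rule `e` to the first `N` simulated samples, and otherwise decide `d`. -/
def inferFrom {k ℓ B N : ℕ} (e : (Fin N → Fin k) → PMF Bool) (d : Bool)
    (w : SIPlayer k ℓ B → Message ℓ) : PMF Bool :=
  if h : N ≤ (simulatedSamples w).length then
    e fun i => (simulatedSamples w).get ⟨i, lt_of_lt_of_le i.isLt h⟩
  else PMF.pure d

/-- The simulate-and-infer protocol with `B` blocks, a centralized decision rule `e` for `N`
samples, and the decision `d` when fewer than `N` samples are simulated. Players use no coin. -/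
def simulateAndInfer (k ℓ B : ℕ) {N : ℕ} (e : (Fin N → Fin k) → PMF Bool) (d : Bool) :
    PrivateCoinTester (SIPlayer k ℓ B) k ℓ where
  comm :=
    { Coin := fun _ => Unit
      coinLaw := fun _ => PMF.pure ()
      channel := fun t _ x => PMF.pure (playerMessage ℓ t.2.2.1 x) }
  referee := fun w => (indepLaw fun t => flipMessage (w t)).bind (inferFrom e d)

/-- Simulate-and-infer solves identity testing with `n` players: for some numbers `B` of blocks
and `N` of simulated samples there are exactly `n` players, and for every reference
distribution `q` there is a centralized `(N, ε, δ)`-test for which simulate-and-infer, with any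
decision `d` in the case of too few samples, is an `ℓ`-bit deterministic
`(k, ε, δ)`-identity testing protocol. -/
def SimulateAndInferTestsIdentity (k ℓ : ℕ) (ε δ : ℝ) (n : ℕ) : Prop :=
  ∃ B N : ℕ, Fintype.card (SIPlayer k ℓ B) = n ∧
    ∀ q : PMF (Fin k), ∃ e : (Fin N → Fin k) → PMF Bool, IsIdentityTest q ε δ e ∧
      ∀ d : Bool, (simulateAndInfer k ℓ B e d).comm.IsDeterministic ∧
        (simulateAndInfer k ℓ B e d).IsIdentityTester q ε δ

end

/-! The proof combines an exact simulation of samples with a centralized test whose error is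
exponentially small.

Simulation. Let `a_j` be half the mass of the part `S_j`, the probability that a flipped message of
a player watching `S_j` is nonzero. A fixed odd-numbered player of part `j` yields `x` with
probability `p x / 2`, times the factors `1 - a_i` of the other odd-numbered players, times the
factor `1 - a_j` of the companion. The companion restores exactly the factor missing from the
product, so a block returns `x` with probability `p x * (∏ (1 - a_j)) ^ 2` (`toReal_blockLaw_some`).
Given success the symbol has law exactly `p`, and since `∑ a_j = 1 / 2` the success probability is
at least `1 / 4` (`blockSuccess_mem`). Hence a constant multiple of `N + log (1 / δ)` blocks
suffices for `N` samples.

Test. Each element `x` is split into `⌊K * q x⌋ + 1` bins, so that every bin has reference mass at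
most `1 / K` and there are at most `2 * K` bins. A fair coin replaces each sample by a fresh
reference draw and is kept as a bit. Given the bins the bits are independent, with sign mean `θ = (P
- Q) / (P + Q)`. The statistic sums products of signs over pairs inside each bin, using only a
capped number of bits per bin. It is centred under the reference law, and otherwise has a drift
governed by `θ ^ 2` times the number of pairs.

Concentration is by exponential moments. A quadratic potential treats the bits of one bin
(`listMean_exp_neg_pairSum_le`, `listMean_exp_pairSum_le`), negative association replaces
multinomial counts by independent binomials (`listMean_prod_count_le`), and the binomials are
bounded by supermartingales. The errors are at most `exp (-L)` once `N ^ 2 * ε ^ 4` is of order `K *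
L`. Choosing `K` of order `k + L` gives `N` of order `(√(k * L) + L) / ε ^ 2`. -/

noncomputable section

/-! ### Means over lists of independent samples -/

/-- The mean of `F` over lists of `n` independent symbols with weights `P`. -/
def listMean {α : Type} [Fintype α] (P : α → ℝ) : ℕ → (List α → ℝ) → ℝ
  | 0, F => F []
  | n + 1, F => ∑ a, P a * listMean P n fun l => F (a :: l)

section ListMean

variable {α : Type} [Fintype α] {P : α → ℝ}

theorem sum_prod_mul_ofFn (P : α → ℝ) (n : ℕ) (F : List α → ℝ) :
    ∑ f : Fin n → α, (∏ i, P (f i)) * F (List.ofFn f) = listMean P n F := by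
  induction n generalizing F with
  | zero => simp [listMean]
  | succ n ih =>
    rw [← (Fin.consEquiv fun _ : Fin (n + 1) => α).sum_comp, Fintype.sum_prod_type]
    simp only [listMean, ← ih, Finset.mul_sum]
    refine Finset.sum_congr rfl fun a _ => Finset.sum_congr rfl fun f _ => ?_
    simp [Fin.consEquiv, Fin.prod_univ_succ, List.ofFn_succ, mul_assoc]

theorem listMean_mono (hP : ∀ a, 0 ≤ P a) {n : ℕ} {F G : List α → ℝ}
    (h : ∀ l, l.length = n → F l ≤ G l) : listMean P n F ≤ listMean P n G := by
  induction n generalizing F G with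
  | zero => exact h [] rfl
  | succ n ih =>
    exact Finset.sum_le_sum fun a _ => mul_le_mul_of_nonneg_left
      (ih fun l hl => h _ (by simp [hl])) (hP a)

theorem listMean_nonneg (hP : ∀ a, 0 ≤ P a) {n : ℕ} {F : List α → ℝ} (h : ∀ l, 0 ≤ F l) :
    0 ≤ listMean P n F := by
  induction n generalizing F with
  | zero => exact h []
  | succ n ih => exact Finset.sum_nonneg fun a _ => mul_nonneg (hP a) (ih fun l => h _)

theorem listMean_add (n : ℕ) (F G : List α → ℝ) :
    listMean P n (fun l => F l + G l) = listMean P n F + listMean P n G := by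
  induction n generalizing F G with
  | zero => rfl
  | succ n ih => simp only [listMean, ih, mul_add, Finset.sum_add_distrib]

theorem listMean_const_mul (n : ℕ) (c : ℝ) (F : List α → ℝ) :
    listMean P n (fun l => c * F l) = c * listMean P n F := by
  induction n generalizing F with
  | zero => rfl
  | succ n ih =>
    simp only [listMean, ih, Finset.mul_sum]
    exact Finset.sum_congr rfl fun a _ => by ring

theorem listMean_sum {ι : Type} (s : Finset ι) (n : ℕ) (F : ι → List α → ℝ) :
    listMean P n (fun l => ∑ i ∈ s, F i l) = ∑ i ∈ s, listMean P n (F i) := by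
  induction n generalizing F with
  | zero => rfl
  | succ n ih =>
    simp only [listMean, ih, Finset.mul_sum]
    exact Finset.sum_comm

theorem listMean_const (hP : ∑ a, P a = 1) (n : ℕ) (c : ℝ) :
    listMean P n (fun _ => c) = c := by
  induction n with
  | zero => rfl
  | succ n ih => simp only [listMean, ih, ← Finset.sum_mul, hP, one_mul]

theorem listMean_take (hP : ∑ a, P a = 1) (n r : ℕ) (F : List α → ℝ) :
    listMean P n (fun l => F (l.take r)) = listMean P (min n r) F := by
  induction n generalizing r F with
  | zero => simp [listMean]
  | succ n ih =>
    cases r with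
    | zero => simpa [listMean] using listMean_const hP (n + 1) (F [])
    | succ r =>
      rw [Nat.succ_min_succ]
      simp only [listMean, List.take_succ_cons]
      exact Finset.sum_congr rfl fun a _ => by rw [ih r fun l => F (a :: l)]

end ListMean

/-! ### Binomial means -/

/-- The mean of `g` under the binomial distribution with `n` trials of success probability `w`. -/
def binMean (w : ℝ) : ℕ → (ℕ → ℝ) → ℝ
  | 0, g => g 0
  | N + 1, g => binMean w N fun n => (1 - w) * g n + w * g (n + 1)

section BinMean

variable {w : ℝ}

theorem binMean_mono (h0 : 0 ≤ w) (h1 : w ≤ 1) {N : ℕ} {f g : ℕ → ℝ} (h : ∀ n, f n ≤ g n) :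
    binMean w N f ≤ binMean w N g := by
  induction N generalizing f g with
  | zero => exact h 0
  | succ N ih =>
    exact ih fun n => add_le_add (mul_le_mul_of_nonneg_left (h n) (by linarith))
      (mul_le_mul_of_nonneg_left (h _) h0)

theorem binMean_nonneg (h0 : 0 ≤ w) (h1 : w ≤ 1) {N : ℕ} {f : ℕ → ℝ} (h : ∀ n, 0 ≤ f n) :
    0 ≤ binMean w N f := by
  induction N generalizing f with
  | zero => exact h 0
  | succ N ih =>
    exact ih fun n => add_nonneg (mul_nonneg (by linarith) (h n)) (mul_nonneg h0 (h _))

theorem binMean_trials_add (M N : ℕ) (g : ℕ → ℝ) :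
    binMean w (M + N) g = binMean w M fun m => binMean w N fun n => g (m + n) := by
  induction N generalizing g with
  | zero => rfl
  | succ N ih => exact ih _

/-- Supermartingale principle: `F j n` is a bound when `j` trials remain and `n` successes have
occurred, so only a one-trial inequality has to be checked. -/
theorem binMean_le_of_potential (h0 : 0 ≤ w) (h1 : w ≤ 1) (N : ℕ) (F : ℕ → ℕ → ℝ)
    (h : ∀ j < N, ∀ n, (1 - w) * F j n + w * F j (n + 1) ≤ F (j + 1) n) :
    binMean w N (F 0) ≤ F N 0 := by
  induction N generalizing F with
  | zero => exact le_rfl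
  | succ N ih =>
    exact (binMean_mono h0 h1 (h 0 N.succ_pos)).trans
      (ih (fun j => F (j + 1)) fun j hj => h (j + 1) (by omega))

theorem exp_le_one_add_two_mul {z : ℝ} (h0 : 0 ≤ z) (h1 : z ≤ 1) : Real.exp z ≤ 1 + 2 * z := by
  have := (abs_le.mp (Real.abs_exp_sub_one_sub_id_le (abs_le.mpr ⟨by linarith, h1⟩))).2
  nlinarith

theorem exp_neg_le_one_sub_half {z : ℝ} (h0 : 0 ≤ z) (h1 : z ≤ 1 / 2) :
    Real.exp (-z) ≤ 1 - z / 2 := by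
  have := (abs_le.mp (Real.abs_exp_sub_one_sub_id_le
    (x := -z) (abs_le.mpr ⟨by linarith, by linarith⟩))).2
  nlinarith

/-- The number of ordered pairs among at most `r` of `n` objects. -/
def cappedPairs (r n : ℕ) : ℝ := (min n r : ℕ) * ((min n r : ℕ) - 1)

theorem binMean_exp_cappedPairs_le (h0 : 0 ≤ w) (h1 : w ≤ 1) {κ : ℝ} (hκ : 0 ≤ κ) (N r : ℕ)
    (h : 2 * κ * r + 4 * κ * (N * w) ≤ 1) :
    binMean w N (fun n => Real.exp (κ * cappedPairs r n)) ≤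
      Real.exp (4 * κ * (N * w) ^ 2) := by
  -- With `j` trials left, new successes pair with the present ones and with each other; the terms
  -- in `j` and `j ^ 2` pay for these two kinds of new pairs.
  let F : ℕ → ℕ → ℝ := fun j n =>
    Real.exp (κ * cappedPairs r n + 4 * w * κ * j * (min n r : ℕ) + 4 * w ^ 2 * κ * j ^ 2)
  have key := binMean_le_of_potential h0 h1 N F ?_
  · simpa [F, cappedPairs, mul_pow, mul_comm, mul_left_comm, mul_assoc] using key
  intro j hj n
  have hwκ : 0 ≤ w * κ := mul_nonneg h0 hκ
  have hww : 0 ≤ w ^ 2 * κ := by positivity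
  -- Above the cap a success changes nothing. Below it a success multiplies the potential by the
  -- exponential of a number in `[0, 1]`, which can be linearized.
  rcases le_or_gt r n with hn | hn
  · simp only [F, cappedPairs, min_eq_right hn, min_eq_right (hn.trans n.le_succ)]
    rw [← add_mul, sub_add_cancel, one_mul]
    refine Real.exp_le_exp.mpr ?_
    push_cast
    nlinarith [mul_nonneg hwκ (Nat.cast_nonneg (α := ℝ) r),
      mul_nonneg hww (Nat.cast_nonneg (α := ℝ) j)]
  · have e1 : F j (n + 1) = F j n * Real.exp (2 * κ * n + 4 * w * κ * j) := by
      simp only [F, cappedPairs, min_eq_left hn.le, min_eq_left (Nat.succ_le_of_lt hn),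
        ← Real.exp_add]
      congr 1
      push_cast
      ring
    have hz0 : 0 ≤ 2 * κ * n + 4 * w * κ * j := by positivity
    have hz1 : 2 * κ * n + 4 * w * κ * j ≤ 1 := by
      have a : (n : ℝ) ≤ r := by exact_mod_cast hn.le
      have b : (j : ℝ) ≤ N := by exact_mod_cast hj.le
      nlinarith [mul_le_mul_of_nonneg_left a hκ, mul_le_mul_of_nonneg_left b hwκ]
    have hF : 0 < F j n := Real.exp_pos _
    calc (1 - w) * F j n + w * F j (n + 1)
        = F j n * (1 - w + w * Real.exp (2 * κ * n + 4 * w * κ * j)) := by rw [e1]; ring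
      _ ≤ F j n * Real.exp (2 * w * (2 * κ * n + 4 * w * κ * j)) := by
          refine mul_le_mul_of_nonneg_left ?_ hF.le
          have := mul_le_mul_of_nonneg_left (exp_le_one_add_two_mul hz0 hz1) h0
          have := Real.add_one_le_exp (2 * w * (2 * κ * n + 4 * w * κ * j))
          nlinarith
      _ ≤ F (j + 1) n := by
          simp only [F, ← Real.exp_add]
          refine Real.exp_le_exp.mpr ?_
          rw [min_eq_left hn.le]
          push_cast
          nlinarith

/-- The cap is replaced by the smooth minorant `r * (1 - ρ ^ n) ≤ min n r`, whose gap to `r` shrinks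
by the constant factor `ρ` with each success. This gives a closed potential. -/
theorem binMean_exp_neg_mul_min_le (h0 : 0 ≤ w) (h1 : w ≤ 1) {u : ℝ} (hu0 : 0 ≤ u)
    (hu1 : u ≤ 1 / 2) {r : ℕ} (hr : 1 ≤ r) (N : ℕ) (h : N * w ≤ r) :
    binMean w N (fun n => Real.exp (-(u * (min n r : ℕ)))) ≤ Real.exp (-(u * (N * w) / 4)) := by
  have hr0 : (1 : ℝ) ≤ r := by exact_mod_cast hr
  have hrp : (0 : ℝ) < r := by linarith
  set ρ : ℝ := 1 - 1 / r with hρ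
  -- The mean of `ρ` to a single trial is `1 - w / r`; half of the decrement is given up in
  -- linearizing `exp (-v)`.
  set q : ℝ := 1 - w / (2 * r) with hq
  have hinv : 1 / (r : ℝ) ≤ 1 := by rw [div_le_one hrp]; exact hr0
  have hρ0 : 0 ≤ ρ := by rw [hρ]; linarith
  have hρ1 : ρ ≤ 1 := by rw [hρ]; linarith [one_div_pos.mpr hrp]
  have hw2 : w / (2 * r) ≤ 1 / 2 := by
    rw [div_le_div_iff₀ (by positivity) (by norm_num)]; nlinarith
  have hw20 : 0 ≤ w / (2 * r) := by positivity
  have hq0 : 0 ≤ q := by rw [hq]; linarith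
  have hq1 : q ≤ 1 := by rw [hq]; linarith
  let F : ℕ → ℕ → ℝ := fun j n => Real.exp (-(u * r * (1 - ρ ^ n * q ^ j)))
  have key := binMean_le_of_potential h0 h1 N F ?_
  · refine (binMean_mono h0 h1 (g := F 0) fun n => ?_).trans (key.trans ?_)
    · refine Real.exp_le_exp.mpr (neg_le_neg ?_)
      rw [mul_assoc]
      refine mul_le_mul_of_nonneg_left ?_ hu0
      rw [pow_zero, mul_one, Nat.cast_min]
      have hb : 1 + (n : ℝ) * (-(1 / r)) ≤ (1 + (-(1 / (r : ℝ)))) ^ n :=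
        one_add_mul_le_pow (by linarith) n
      refine le_min ?_ ?_
      · have : (1 - ρ ^ n) ≤ n * (1 / r) := by
          have e : (1 + (-(1 / (r : ℝ)))) = ρ := by rw [hρ]; ring
          rw [e] at hb; linarith
        calc r * (1 - ρ ^ n) ≤ r * (n * (1 / r)) := mul_le_mul_of_nonneg_left this hrp.le
          _ = n := by field_simp
      · nlinarith [pow_nonneg hρ0 n]
    · refine Real.exp_le_exp.mpr (neg_le_neg ?_)
      set x : ℝ := N * w / (2 * r) with hx
      have hx0 : 0 ≤ x := by positivity
      have hx1 : x ≤ 1 / 2 := by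
        rw [hx, div_le_div_iff₀ (by positivity) (by norm_num)]; linarith
      have hqN : q ^ N ≤ 1 - x / 2 := by
        calc q ^ N ≤ Real.exp (-(w / (2 * r))) ^ N := by
              refine pow_le_pow_left₀ hq0 ?_ N
              have := Real.add_one_le_exp (-(w / (2 * r)))
              rw [hq]; linarith
          _ = Real.exp (-x) := by
              rw [← Real.exp_nat_mul, hx]; congr 1; ring
          _ ≤ 1 - x / 2 := exp_neg_le_one_sub_half hx0 hx1
      have e : u * (N * w) / 4 = u * r * (x / 2) := by rw [hx]; field_simp; ring
      rw [e]
      refine mul_le_mul_of_nonneg_left ?_ (by positivity)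
      rw [pow_zero, one_mul]; linarith
  intro j _ n
  set v : ℝ := u * (ρ ^ n * q ^ j) with hv
  have hρq0 : 0 ≤ ρ ^ n * q ^ j := by positivity
  have hρq1 : ρ ^ n * q ^ j ≤ 1 := mul_le_one₀ (pow_le_one₀ hρ0 hρ1) (by positivity)
    (pow_le_one₀ hq0 hq1)
  have hv0 : 0 ≤ v := by positivity
  have hv1 : v ≤ 1 / 2 := by nlinarith
  have e1 : F j (n + 1) = F j n * Real.exp (-v) := by
    simp only [F, ← Real.exp_add]
    congr 1
    rw [hv, pow_succ, hρ]
    field_simp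
    ring
  have e2 : F (j + 1) n = F j n * Real.exp (-(w * v / 2)) := by
    simp only [F, ← Real.exp_add]
    congr 1
    rw [hv, pow_succ q, hq]
    field_simp
    ring
  have hF : 0 < F j n := Real.exp_pos _
  rw [e1, e2]
  have h3 := mul_le_mul_of_nonneg_left (exp_neg_le_one_sub_half hv0 hv1) h0
  have h4 := Real.add_one_le_exp (-(w * v / 2))
  nlinarith

/-- Only pairs with one member in each half of the trials are kept. Their number is bilinear in the
capped counts of the halves, so the linear bound applies twice. This is why the sample size has the
form `N + N` and the cap the form `2 * r`. -/
theorem binMean_exp_neg_cappedPairs_le (h0 : 0 ≤ w) (h1 : w ≤ 1) {κ : ℝ} (hκ : 0 ≤ κ)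
    {r : ℕ} (hr : 1 ≤ r) (hκr : κ * r ≤ 1 / 4) (N : ℕ) (h : N * w ≤ r) :
    binMean w (N + N) (fun n => Real.exp (-(κ * cappedPairs (2 * r) n))) ≤
      Real.exp (-(κ * (N * w) ^ 2 / 8)) := by
  rw [binMean_trials_add]
  have hNw : 0 ≤ N * w := by positivity
  calc binMean w N (fun m => binMean w N fun n =>
          Real.exp (-(κ * cappedPairs (2 * r) (m + n))))
      ≤ binMean w N (fun m => Real.exp (-((κ * (N * w) / 2) * (min m r : ℕ)))) := by
        refine binMean_mono h0 h1 fun m => ?_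
        have hm : ((min m r : ℕ) : ℝ) ≤ r := by exact_mod_cast min_le_right m r
        have := mul_le_mul_of_nonneg_left hm hκ
        refine (binMean_mono h0 h1 (g := fun n =>
          Real.exp (-((2 * κ * (min m r : ℕ)) * (min n r : ℕ)))) fun n => ?_).trans
          ((binMean_exp_neg_mul_min_le h0 h1 (by positivity) (by nlinarith) hr N h).trans_eq
            (by congr 1; ring))
        refine Real.exp_le_exp.mpr (neg_le_neg ?_)
        rw [mul_assoc, mul_comm 2 κ, mul_assoc]
        refine mul_le_mul_of_nonneg_left ?_ hκ
        rw [cappedPairs]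
        generalize ha : min m r = a
        generalize hb : min n r = b
        have hab : a + b ≤ min (m + n) (2 * r) := by omega
        generalize min (m + n) (2 * r) = t at hab
        have h1 : a * (a - 1) + b * (b - 1) + 2 * (a * b) ≤ t * (t - 1) := by
          calc a * (a - 1) + b * (b - 1) + 2 * (a * b) = (a + b) * (a + b - 1) := by
                rcases a with _ | a
                · simp
                rcases b with _ | b
                · simp
                simp only [Nat.add_sub_cancel, show a + 1 + (b + 1) - 1 = a + b + 1 by omega]
                ring
            _ ≤ _ := Nat.mul_le_mul hab (by omega)
        have h2 : 2 * (a * b) ≤ t * (t - 1) := by omega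
        have h3 : ((t * (t - 1) : ℕ) : ℝ) = t * (t - 1) := by
          rcases t with _ | t <;> push_cast <;> simp
        rw [← h3]
        exact_mod_cast h2
    _ ≤ Real.exp (-(κ * (N * w) / 2 * (N * w) / 4)) :=
        binMean_exp_neg_mul_min_le h0 h1 (by positivity) (by nlinarith) hr N h
    _ = _ := by congr 1; ring

end BinMean

/-! ### The pair statistic of a list of bits -/

/-- A bit as a sign. -/
def bitSign (b : Bool) : ℝ := if b then 1 else -1

/-- The sum of the signs of a list of bits. -/
def signSum (l : List Bool) : ℝ := (l.map bitSign).sum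

/-- The law of a bit whose sign has mean `θ`. -/
def biasedBit (θ : ℝ) (b : Bool) : ℝ := (1 + bitSign b * θ) / 2

theorem sum_biasedBit (θ : ℝ) : ∑ b, biasedBit θ b = 1 := by
  simp [biasedBit, bitSign]; ring

theorem biasedBit_nonneg {θ : ℝ} (hθ : |θ| ≤ 1) (b : Bool) : 0 ≤ biasedBit θ b := by
  have := abs_le.mp hθ
  cases b <;> simp [biasedBit, bitSign] <;> linarith

/-- Hoeffding's lemma for a sign of mean `θ`. -/
theorem sum_biasedBit_mul_exp_le {θ : ℝ} (hθ : |θ| ≤ 1) (u : ℝ) :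
    ∑ b, biasedBit θ b * Real.exp (u * bitSign b) ≤ Real.exp (θ * u + u ^ 2 / 2) := by
  classical
  let p : PMF Bool := PMF.ofFintype (fun b => ENNReal.ofReal (biasedBit θ b)) (by
    rw [← ENNReal.ofReal_sum_of_nonneg fun b _ => biasedBit_nonneg hθ b, sum_biasedBit,
      ENNReal.ofReal_one])
  have hint : ∀ f : Bool → ℝ, ∫ b, f b ∂p.toMeasure = ∑ b, biasedBit θ b * f b := by
    intro f
    rw [PMF.integral_eq_sum]
    refine Finset.sum_congr rfl fun b _ => ?_
    simp [p, ENNReal.toReal_ofReal (biasedBit_nonneg hθ b)]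
  have h := (ProbabilityTheory.hasSubgaussianMGF_of_mem_Icc (μ := p.toMeasure)
    (X := bitSign) (a := -1) (b := 1) (measurable_of_finite _).aemeasurable
    (Filter.Eventually.of_forall fun b => by cases b <;> simp [bitSign])).mgf_le u
  have hmean : ∫ b, bitSign b ∂p.toMeasure = θ := by
    rw [hint]; simp [biasedBit, bitSign]; ring
  rw [ProbabilityTheory.mgf, hint, hmean] at h
  have e : ∀ b, Real.exp (u * bitSign b) =
      Real.exp (θ * u) * Real.exp (u * (bitSign b - θ)) := fun b => by
    rw [← Real.exp_add]; congr 1; ring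
  have hc : (((‖(1 : ℝ) - -1‖₊ / 2) ^ 2 : NNReal) : ℝ) = 1 := by
    push_cast; norm_num
  rw [hc] at h
  calc ∑ b, biasedBit θ b * Real.exp (u * bitSign b)
      = Real.exp (θ * u) * ∑ b, biasedBit θ b * Real.exp (u * (bitSign b - θ)) := by
        rw [Finset.mul_sum]
        exact Finset.sum_congr rfl fun b _ => by rw [e b]; ring
    _ ≤ Real.exp (θ * u) * Real.exp (1 * u ^ 2 / 2) :=
        mul_le_mul_of_nonneg_left h (Real.exp_pos _).le
    _ = _ := by rw [← Real.exp_add]; congr 1; ring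

theorem signSum_cons (b : Bool) (l : List Bool) : signSum (b :: l) = bitSign b + signSum l := by
  simp [signSum]

theorem bitSign_sq (b : Bool) : bitSign b ^ 2 = 1 := by cases b <;> simp [bitSign]

/-- The offset `s` makes the induction close: averaging over one bit keeps the bound
exponential-quadratic in `s`. The linear coefficient `θ * ξ` records the drift, and it is what
produces the gain of order `η * θ ^ 2 * n ^ 2` in the constant term. -/
theorem listMean_exp_neg_sq_signSum_le {θ η : ℝ} (hθ : |θ| ≤ 1) (hη : 0 ≤ η) (n : ℕ)
    (h : η * n ≤ 1 / 8) :
    ∃ ξ, η * n / 4 ≤ ξ ∧ ξ ≤ η * n ∧ ∀ s : ℝ,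
      listMean (biasedBit θ) n (fun l => Real.exp (-(η / 2 * (s + signSum l) ^ 2))) ≤
        Real.exp (-((η / 2 - n * η ^ 2) * s ^ 2 + θ * ξ * s +
          (n * η / 2 - η ^ 2 * (n * (n - 1)) / 2 + η * θ ^ 2 * (n * (n - 1)) / 16))) := by
  induction n with
  | zero => exact ⟨0, by simp, by simp, fun s => by simp [listMean, signSum]⟩
  | succ n ih =>
    push_cast at h
    have hn : (0 : ℝ) ≤ n := Nat.cast_nonneg n
    obtain ⟨ξ, hξ1, hξ2, hs⟩ := ih (by nlinarith)
    set y : ℝ := η / 2 - n * η ^ 2 with hy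
    have hnη : 0 ≤ η * n := by positivity
    have hy1 : η / 4 ≤ y := by rw [hy]; nlinarith
    have hy2 : y ≤ η / 2 := by rw [hy]; nlinarith
    have hξ0 : 0 ≤ ξ := by linarith
    have hξ8 : ξ ≤ 1 / 8 := by nlinarith
    -- The new coefficient of `θ * s`: `ξ` is inherited, `2 * y` comes from the mean of the new bit,
    -- and `-2 * y * ξ` from the cross term of Hoeffding's bound.
    refine ⟨ξ + 2 * y - 2 * y * ξ, ?_, ?_, fun s => ?_⟩
    · push_cast; nlinarith [mul_nonneg (by linarith : (0:ℝ) ≤ y) (by linarith : 0 ≤ 1 / 8 - ξ)]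
    · push_cast; nlinarith [mul_nonneg (by linarith : (0:ℝ) ≤ y) hξ0]
    set c : ℝ := n * η / 2 - η ^ 2 * (n * (n - 1)) / 2 + η * θ ^ 2 * (n * (n - 1)) / 16 with hc
    calc listMean (biasedBit θ) (n + 1) (fun l => Real.exp (-(η / 2 * (s + signSum l) ^ 2)))
        = ∑ b, biasedBit θ b * listMean (biasedBit θ) n
            (fun l => Real.exp (-(η / 2 * ((s + bitSign b) + signSum l) ^ 2))) := by
          simp only [listMean, signSum_cons, add_assoc]
      _ ≤ ∑ b, biasedBit θ b *
            Real.exp (-(y * (s + bitSign b) ^ 2 + θ * ξ * (s + bitSign b) + c)) :=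
          Finset.sum_le_sum fun b _ =>
            mul_le_mul_of_nonneg_left (hs _) (biasedBit_nonneg hθ b)
      _ = Real.exp (-(y * s ^ 2 + y + θ * ξ * s + c)) *
            ∑ b, biasedBit θ b * Real.exp (-(2 * y * s + θ * ξ) * bitSign b) := by
          rw [Finset.mul_sum]
          refine Finset.sum_congr rfl fun b _ => ?_
          rw [mul_left_comm, ← Real.exp_add]
          congr 2
          linear_combination (-y) * bitSign_sq b
      _ ≤ Real.exp (-(y * s ^ 2 + y + θ * ξ * s + c)) *
            Real.exp (θ * -(2 * y * s + θ * ξ) + (-(2 * y * s + θ * ξ)) ^ 2 / 2) :=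
          mul_le_mul_of_nonneg_left (sum_biasedBit_mul_exp_le hθ _) (Real.exp_pos _).le
      _ ≤ _ := by
          rw [← Real.exp_add]
          refine Real.exp_le_exp.mpr ?_
          have a1 : 0 ≤ (η ^ 2 - 2 * y ^ 2) * s ^ 2 :=
            mul_nonneg (by nlinarith) (sq_nonneg s)
          have a2 : 0 ≤ θ ^ 2 * (ξ - ξ ^ 2 / 2 - η * n / 8) :=
            mul_nonneg (sq_nonneg θ) (by nlinarith)
          push_cast
          rw [hc]
          have e : η / 2 - (n + 1) * η ^ 2 = y - η ^ 2 := by rw [hy]; ring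
          rw [e]
          have e2 : y = η / 2 - n * η ^ 2 := hy
          nlinarith

theorem listMean_exp_sq_signSum_le {η : ℝ} (hη : 0 ≤ η) (n : ℕ) (h : η * n ≤ 1 / 8) (s : ℝ) :
    listMean (biasedBit 0) n (fun l => Real.exp (η / 2 * (s + signSum l) ^ 2)) ≤
      Real.exp ((η / 2 + n * η ^ 2) * s ^ 2 + (n * η / 2 + η ^ 2 * (n * (n - 1)) / 2)) := by
  induction n generalizing s with
  | zero => simp [listMean, signSum]
  | succ n ih =>
    push_cast at h
    have hn : (0 : ℝ) ≤ n := Nat.cast_nonneg n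
    have hs := ih (by nlinarith)
    have hθ : |(0 : ℝ)| ≤ 1 := by simp
    set y : ℝ := η / 2 + n * η ^ 2 with hy
    have hnη : 0 ≤ η * n := by positivity
    have hy1 : 0 ≤ y := by positivity
    have hy2 : y ≤ 5 / 8 * η := by rw [hy]; nlinarith
    set c : ℝ := n * η / 2 + η ^ 2 * (n * (n - 1)) / 2 with hc
    calc listMean (biasedBit 0) (n + 1) (fun l => Real.exp (η / 2 * (s + signSum l) ^ 2))
        = ∑ b, biasedBit 0 b * listMean (biasedBit 0) n
            (fun l => Real.exp (η / 2 * ((s + bitSign b) + signSum l) ^ 2)) := by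
          simp only [listMean, signSum_cons, add_assoc]
      _ ≤ ∑ b, biasedBit 0 b * Real.exp (y * (s + bitSign b) ^ 2 + c) :=
          Finset.sum_le_sum fun b _ =>
            mul_le_mul_of_nonneg_left (hs _) (biasedBit_nonneg hθ b)
      _ = Real.exp (y * s ^ 2 + y + c) *
            ∑ b, biasedBit 0 b * Real.exp ((2 * y * s) * bitSign b) := by
          rw [Finset.mul_sum]
          refine Finset.sum_congr rfl fun b _ => ?_
          rw [mul_left_comm, ← Real.exp_add]
          congr 2
          linear_combination y * bitSign_sq b
      _ ≤ Real.exp (y * s ^ 2 + y + c) * Real.exp (0 * (2 * y * s) + (2 * y * s) ^ 2 / 2) :=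
          mul_le_mul_of_nonneg_left (sum_biasedBit_mul_exp_le hθ _) (Real.exp_pos _).le
      _ ≤ _ := by
          rw [← Real.exp_add]
          refine Real.exp_le_exp.mpr ?_
          have a1 : 0 ≤ (η ^ 2 - 2 * y ^ 2) * s ^ 2 :=
            mul_nonneg (by nlinarith) (sq_nonneg s)
          push_cast
          rw [hc]
          have e : η / 2 + (n + 1) * η ^ 2 = y + η ^ 2 := by rw [hy]; ring
          rw [e]
          have e2 : y = η / 2 + n * η ^ 2 := hy
          nlinarith

/-- The sum of the products of the signs of all pairs among the first `r` bits. -/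
def pairSum (r : ℕ) (l : List Bool) : ℝ :=
  (signSum (l.take r) ^ 2 - (l.take r).length) / 2

theorem listMean_congr_length {α : Type} [Fintype α] {P : α → ℝ} {n : ℕ} {F G : List α → ℝ}
    (h : ∀ l, l.length = n → F l = G l) : listMean P n F = listMean P n G := by
  induction n generalizing F G with
  | zero => exact h [] rfl
  | succ n ih =>
    exact Finset.sum_congr rfl fun a _ => by rw [ih fun l hl => h (a :: l) (by simp [hl])]

/-- The diagonal of the squared sign sum is the number of bits, which is deterministic and factors
out. -/
theorem listMean_exp_pairSum (θ c : ℝ) (r n : ℕ) :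
    listMean (biasedBit θ) n (fun l => Real.exp (c * pairSum r l)) =
      Real.exp (-(c / 2 * (min n r : ℕ))) *
        listMean (biasedBit θ) (min n r) (fun l => Real.exp (c / 2 * (0 + signSum l) ^ 2)) := by
  have h := listMean_take (sum_biasedBit θ) n r
    (fun l => Real.exp (c * ((signSum l ^ 2 - l.length) / 2)))
  simp only [pairSum]
  rw [h, ← listMean_const_mul]
  refine listMean_congr_length fun l hl => ?_
  rw [← Real.exp_add, hl]
  congr 1
  ring

theorem mul_min_le_of_mul_le {η : ℝ} (hη : 0 ≤ η) {r : ℕ} (h : η * r ≤ 1 / 8) (n : ℕ) :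
    η * (min n r : ℕ) ≤ 1 / 8 :=
  (mul_le_mul_of_nonneg_left (by exact_mod_cast min_le_right n r) hη).trans h

theorem listMean_exp_neg_pairSum_le {θ η : ℝ} (hθ : |θ| ≤ 1) (hη : 0 ≤ η) {r : ℕ}
    (h : η * r ≤ 1 / 8) (n : ℕ) :
    listMean (biasedBit θ) n (fun l => Real.exp (-η * pairSum r l)) ≤
      Real.exp ((η ^ 2 / 2 - η * θ ^ 2 / 16) * cappedPairs r n) := by
  obtain ⟨ξ, -, -, hs⟩ := listMean_exp_neg_sq_signSum_le hθ hη _ (mul_min_le_of_mul_le hη h n)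
  rw [listMean_exp_pairSum]
  have := hs 0
  simp only [neg_div, neg_mul] at this ⊢
  refine (mul_le_mul_of_nonneg_left this (Real.exp_pos _).le).trans_eq ?_
  rw [← Real.exp_add, cappedPairs]
  congr 1
  ring

theorem listMean_exp_pairSum_le {η : ℝ} (hη : 0 ≤ η) {r : ℕ} (h : η * r ≤ 1 / 8) (n : ℕ) :
    listMean (biasedBit 0) n (fun l => Real.exp (η * pairSum r l)) ≤
      Real.exp (η ^ 2 / 2 * cappedPairs r n) := by
  rw [listMean_exp_pairSum]
  have := listMean_exp_sq_signSum_le hη _ (mul_min_le_of_mul_le hη h n) 0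
  refine (mul_le_mul_of_nonneg_left this (Real.exp_pos _).le).trans_eq ?_
  rw [← Real.exp_add, cappedPairs]
  congr 1
  ring

/-! ### Symbols with a bin and a bit -/

section Bins

variable {Y : Type} [DecidableEq Y]

/-- The bits of the symbols in the bin `y`. -/
def binBits (y : Y) (l : List (Y × Bool)) : List Bool :=
  l.filterMap fun a => if a.1 = y then some a.2 else none

theorem binBits_cons (y : Y) (a : Y × Bool) (l : List (Y × Bool)) :
    binBits y (a :: l) = if a.1 = y then a.2 :: binBits y l else binBits y l := by
  unfold binBits
  rw [List.filterMap_cons]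
  split_ifs <;> simp_all

/-- The first-order expansion of a product is a lower bound when all increments have the same sign.
It serves both the negative association of counts and the union bound for a block. -/
theorem prod_add_sum_mul_prod_erase_le (s : Finset Y) {a d w : Y → ℝ} (ha : ∀ y, 0 ≤ a y)
    (hw : ∀ y, 0 ≤ w y) (had : ∀ y, 0 ≤ a y + w y * d y)
    (hd : (∀ y, 0 ≤ d y) ∨ ∀ y, d y ≤ 0) :
    ∏ y ∈ s, a y + ∑ x ∈ s, w x * d x * ∏ y ∈ s.erase x, a y ≤ ∏ y ∈ s, (a y + w y * d y) := by
  induction s using Finset.induction_on with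
  | empty => simp
  | insert z s hz ih =>
    rw [Finset.prod_insert hz, Finset.prod_insert hz, Finset.sum_insert hz,
      Finset.erase_insert hz]
    have e : ∑ x ∈ s, w x * d x * ∏ y ∈ (insert z s).erase x, a y =
        a z * ∑ x ∈ s, w x * d x * ∏ y ∈ s.erase x, a y := by
      rw [Finset.mul_sum]
      refine Finset.sum_congr rfl fun x hx => ?_
      have hzx : z ≠ x := fun h => hz (h ▸ hx)
      rw [Finset.erase_insert_of_ne hzx, Finset.prod_insert fun h => hz (Finset.mem_of_mem_erase h)]
      ring
    rw [e]
    set S := ∑ x ∈ s, w x * d x * ∏ y ∈ s.erase x, a y with hS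
    have h1 := mul_le_mul_of_nonneg_left ih (had z)
    have h2 : 0 ≤ w z * d z * S := by
      have hp : ∀ x, 0 ≤ ∏ y ∈ s.erase x, a y := fun x => Finset.prod_nonneg fun y _ => ha y
      rcases hd with hd | hd
      · exact mul_nonneg (mul_nonneg (hw z) (hd z))
          (Finset.sum_nonneg fun x _ => mul_nonneg (mul_nonneg (hw x) (hd x)) (hp x))
      · exact mul_nonneg_of_nonpos_of_nonpos (mul_nonpos_of_nonneg_of_nonpos (hw z) (hd z))
          (Finset.sum_nonpos fun x _ => mul_nonpos_of_nonpos_of_nonneg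
            (mul_nonpos_of_nonneg_of_nonpos (hw x) (hd x)) (hp x))
    nlinarith

variable [Fintype Y]

/-- Conditioning on the bins: the bits of different bins are then independent, and only the counts
of the bins matter. -/
theorem listMean_prod_binBits {W : Y × Bool → ℝ} {π : Y → ℝ} {β : Y → Bool → ℝ}
    (hW : ∀ y b, W (y, b) = π y * β y b) (N : ℕ) (F : Y → List Bool → ℝ) :
    listMean W N (fun l => ∏ y, F y (binBits y l)) =
      listMean π N (fun l => ∏ y, listMean (β y) (l.count y) (F y)) := by
  induction N generalizing F with
  | zero => simp [listMean, binBits]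
  | succ N ih =>
    simp only [listMean]
    rw [Fintype.sum_prod_type]
    refine Finset.sum_congr rfl fun y _ => ?_
    have h1 : ∀ b, listMean W N (fun l => ∏ z, F z (binBits z ((y, b) :: l))) =
        listMean π N (fun l => ∏ z, listMean (β z) (l.count z)
          (fun bs => if y = z then F z (b :: bs) else F z bs)) := fun b => by
      rw [← ih]
      congr 1
      funext l
      refine Finset.prod_congr rfl fun z _ => ?_
      rw [binBits_cons]
      split_ifs <;> rfl
    simp only [h1, hW, mul_assoc]
    rw [← Finset.mul_sum]
    congr 1
    simp only [← listMean_const_mul]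
    rw [← listMean_sum]
    congr 1
    funext l
    rw [← Finset.mul_prod_erase _ _ (Finset.mem_univ y), List.count_cons_self]
    simp only [listMean]
    rw [Finset.sum_mul]
    refine Finset.sum_congr rfl fun b _ => ?_
    rw [← Finset.mul_prod_erase _ _ (Finset.mem_univ y), mul_assoc]
    congr 1
    simp only [if_true]
    congr 1
    refine Finset.prod_congr rfl fun z hz => ?_
    have hne : y ≠ z := (Finset.ne_of_mem_erase hz).symm
    simp [hne]

/-! ### Negative association of counts -/

/-- One multinomial draw raises exactly one count, while independent trials may raise several. The
latter gives the larger mean, by the first-order expansion above; averaging over a trial preserves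
monotonicity, so the comparison iterates. -/
theorem listMean_prod_count_le {π : Y → ℝ} (hπ : ∀ y, 0 ≤ π y) (hsum : ∑ y, π y = 1)
    (N : ℕ) {g : Y → ℕ → ℝ} (hg : ∀ y n, 0 ≤ g y n)
    (hmon : (∀ y, Monotone (g y)) ∨ ∀ y, Antitone (g y)) :
    listMean π N (fun l => ∏ y, g y (l.count y)) ≤ ∏ y, binMean (π y) N (g y) := by
  have hπ1 : ∀ y, 0 ≤ 1 - π y := fun y => sub_nonneg.mpr
    (hsum ▸ Finset.single_le_sum (fun z _ => hπ z) (Finset.mem_univ y))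
  induction N generalizing g with
  | zero => simp [listMean, binMean]
  | succ N ih =>
    simp only [listMean, binMean]
    simp only [← listMean_const_mul]
    rw [← listMean_sum]
    refine (listMean_mono hπ fun l _ => ?_).trans (ih (g := fun y n =>
      (1 - π y) * g y n + π y * g y (n + 1)) ?_ ?_)
    · have key := prod_add_sum_mul_prod_erase_le Finset.univ (a := fun y => g y (l.count y))
        (d := fun y => g y (l.count y + 1) - g y (l.count y)) (w := π) (fun y => hg _ _) hπ
        (fun y => by
          have h1 := mul_nonneg (hπ1 y) (hg y (l.count y))
          have h2 := mul_nonneg (hπ y) (hg y (l.count y + 1))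
          nlinarith)
        (hmon.imp (fun h y => sub_nonneg.mpr (h y (Nat.le_succ _)))
          (fun h y => sub_nonpos.mpr (h y (Nat.le_succ _))))
      refine (le_of_eq ?_).trans (key.trans_eq ?_)
      · rw [← one_mul (∏ y, g y (l.count y)), ← hsum, Finset.sum_mul, ← Finset.sum_add_distrib]
        refine Finset.sum_congr rfl fun x _ => ?_
        rw [← Finset.mul_prod_erase _ (fun y => g y (l.count y)) (Finset.mem_univ x),
          ← Finset.mul_prod_erase _ (fun y => g y ((x :: l).count y)) (Finset.mem_univ x)]
        have e : ∏ y ∈ Finset.univ.erase x, g y ((x :: l).count y) =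
            ∏ y ∈ Finset.univ.erase x, g y (l.count y) := by
          refine Finset.prod_congr rfl fun y hy => ?_
          have hne : x ≠ y := (Finset.ne_of_mem_erase hy).symm
          simp [hne]
        rw [e, List.count_cons_self]
        ring
      · exact Finset.prod_congr rfl fun y _ => by ring
    · exact fun y n => add_nonneg (mul_nonneg (hπ1 y) (hg _ _)) (mul_nonneg (hπ y) (hg _ _))
    · refine hmon.imp (fun h y a b hab => ?_) (fun h y a b hab => ?_)
      · exact add_le_add (mul_le_mul_of_nonneg_left (h y hab) (hπ1 y))
          (mul_le_mul_of_nonneg_left (h y (Nat.succ_le_succ hab)) (hπ y))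
      · exact add_le_add (mul_le_mul_of_nonneg_left (h y hab) (hπ1 y))
          (mul_le_mul_of_nonneg_left (h y (Nat.succ_le_succ hab)) (hπ y))

theorem cappedPairs_eq (r n : ℕ) : cappedPairs r n = (min n r * (min n r - 1) : ℕ) := by
  rw [cappedPairs]
  rcases min n r with _ | t <;> push_cast <;> simp

theorem cappedPairs_nonneg (r n : ℕ) : 0 ≤ cappedPairs r n := by
  rw [cappedPairs_eq]; positivity

theorem cappedPairs_mono (r : ℕ) : Monotone (cappedPairs r) := fun m n h => by
  rw [cappedPairs_eq, cappedPairs_eq]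
  have h' : min m r ≤ min n r := min_le_min_right r h
  exact_mod_cast Nat.mul_le_mul h' (Nat.sub_le_sub_right h' 1)

theorem listMean_exp_sum_cappedPairs_le {π κ : Y → ℝ} (hπ : ∀ y, 0 ≤ π y) (hsum : ∑ y, π y = 1)
    (hκ : ∀ y, 0 ≤ κ y) (N r : ℕ) (h : ∀ y, 2 * κ y * r + 4 * κ y * (N * π y) ≤ 1) :
    listMean π N (fun l => Real.exp (∑ y, κ y * cappedPairs r (l.count y))) ≤
      Real.exp (∑ y, 4 * κ y * (N * π y) ^ 2) := by
  have hπ1 : ∀ y, π y ≤ 1 := fun y =>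
    hsum ▸ Finset.single_le_sum (fun z _ => hπ z) (Finset.mem_univ y)
  simp only [Real.exp_sum]
  refine (listMean_prod_count_le hπ hsum N (g := fun y n => Real.exp (κ y * cappedPairs r n))
    (fun y n => (Real.exp_pos _).le) (Or.inl fun y a b hab => Real.exp_le_exp.mpr
      (mul_le_mul_of_nonneg_left (cappedPairs_mono r hab) (hκ y)))).trans ?_
  exact Finset.prod_le_prod (fun y _ => binMean_nonneg (hπ y) (hπ1 y) fun n => (Real.exp_pos _).le)
    fun y _ => binMean_exp_cappedPairs_le (hπ y) (hπ1 y) (hκ y) N r (h y)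

theorem listMean_exp_neg_sum_cappedPairs_le {π κ : Y → ℝ} (hπ : ∀ y, 0 ≤ π y)
    (hsum : ∑ y, π y = 1) (hκ : ∀ y, 0 ≤ κ y) (N : ℕ) {r : ℕ} (hr : 1 ≤ r)
    (h : ∀ y, κ y * r ≤ 1 / 4) (h' : ∀ y, κ y ≠ 0 → N * π y ≤ r) :
    listMean π (N + N) (fun l => Real.exp (-∑ y, κ y * cappedPairs (2 * r) (l.count y))) ≤
      Real.exp (-∑ y, κ y * (N * π y) ^ 2 / 8) := by
  have hπ1 : ∀ y, π y ≤ 1 := fun y =>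
    hsum ▸ Finset.single_le_sum (fun z _ => hπ z) (Finset.mem_univ y)
  simp only [← Finset.sum_neg_distrib, Real.exp_sum]
  refine (listMean_prod_count_le hπ hsum (N + N)
    (g := fun y n => Real.exp (-(κ y * cappedPairs (2 * r) n)))
    (fun y n => (Real.exp_pos _).le) (Or.inr fun y a b hab => Real.exp_le_exp.mpr
      (neg_le_neg (mul_le_mul_of_nonneg_left (cappedPairs_mono _ hab) (hκ y))))).trans ?_
  refine Finset.prod_le_prod
    (fun y _ => binMean_nonneg (hπ y) (hπ1 y) fun n => (Real.exp_pos _).le) fun y _ => ?_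
  -- Bins of coefficient zero may be heavy, so the bound on `N * π y` is not available for them;
  -- both sides are then trivial.
  by_cases hy : κ y = 0
  · have := binMean_exp_cappedPairs_le (hπ y) (hπ1 y) le_rfl (N + N) (2 * r) (by simp)
    simpa [hy] using this
  · exact binMean_exp_neg_cappedPairs_le (hπ y) (hπ1 y) (hκ y) hr (h y) N (h' y hy)

/-! ### The pair statistic over all bins -/

/-- The sum of the pair statistics of all bins. -/
def binStat (r : ℕ) (l : List (Y × Bool)) : ℝ := ∑ y, pairSum r (binBits y l)

/-- The law of a symbol whose bin has law `P` with the bit `true`, and law `Q` with the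
bit `false`, each with probability `1 / 2`. -/
def mixedSymbol (P Q : Y → ℝ) (a : Y × Bool) : ℝ := (if a.2 then P a.1 else Q a.1) / 2

theorem listMean_exp_binStat {P Q : Y → ℝ} (hP : ∀ y, 0 ≤ P y) (hQ : ∀ y, 0 ≤ Q y) (c : ℝ)
    (r N : ℕ) :
    listMean (mixedSymbol P Q) N (fun l => Real.exp (c * binStat r l)) =
      listMean (fun y => (P y + Q y) / 2) N (fun l => ∏ y,
        listMean (biasedBit ((P y - Q y) / (P y + Q y))) (l.count y)
          (fun bs => Real.exp (c * pairSum r bs))) := by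
  rw [← listMean_prod_binBits (W := mixedSymbol P Q)]
  · simp only [binStat, Finset.mul_sum, Real.exp_sum]
  · intro y b
    -- In a bin of mass zero the bias is the default `0 / 0 = 0`, and both sides vanish.
    rcases (add_nonneg (hP y) (hQ y)).eq_or_lt with h | h
    · have h1 : P y = 0 := by linarith [hP y, hQ y]
      have h2 : Q y = 0 := by linarith [hP y, hQ y]
      simp [mixedSymbol, h1, h2]
    · cases b <;> simp only [mixedSymbol, biasedBit, bitSign] <;> simp <;> field_simp <;> ring

theorem listMean_exp_binStat_self_le {Q : Y → ℝ} (hQ : ∀ y, 0 ≤ Q y) (hQ1 : ∑ y, Q y = 1)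
    {K η : ℝ} (hQK : ∀ y, Q y ≤ 1 / K) (hη : 0 ≤ η) (hη1 : η ≤ 1 / 32) {r N : ℕ}
    (hr : η * r ≤ 1 / 8) (hN : η * (N / K) ≤ 1) :
    listMean (mixedSymbol Q Q) N (fun l => Real.exp (η * binStat r l)) ≤
      Real.exp (2 * η ^ 2 * N ^ 2 / K) := by
  rw [listMean_exp_binStat hQ hQ]
  simp only [add_self_div_two, sub_self, zero_div]
  refine (listMean_mono hQ (G := fun l =>
    Real.exp (∑ y, η ^ 2 / 2 * cappedPairs r (l.count y))) fun l _ => ?_).trans ?_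
  · rw [Real.exp_sum]
    exact Finset.prod_le_prod
      (fun y _ => listMean_nonneg (biasedBit_nonneg (by simp)) fun _ => (Real.exp_pos _).le)
      fun y _ => listMean_exp_pairSum_le hη hr _
  · have hNQ : ∀ y, N * Q y ≤ N / K := fun y => by
      rw [div_eq_mul_one_div]
      exact mul_le_mul_of_nonneg_left (hQK y) (Nat.cast_nonneg N)
    refine (listMean_exp_sum_cappedPairs_le hQ hQ1 (fun y => by positivity) N r
      fun y => ?_).trans (Real.exp_le_exp.mpr ?_)
    · nlinarith [mul_le_mul_of_nonneg_left (hNQ y) hη, mul_nonneg hη (Nat.cast_nonneg (α := ℝ) r)]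
    · calc ∑ y, 4 * (η ^ 2 / 2) * (N * Q y) ^ 2
          ≤ ∑ y, 2 * η ^ 2 * N ^ 2 / K * Q y := by
            refine Finset.sum_le_sum fun y _ => ?_
            have := mul_le_mul_of_nonneg_left (hQK y) (hQ y)
            calc 4 * (η ^ 2 / 2) * (N * Q y) ^ 2 = 2 * η ^ 2 * N ^ 2 * (Q y * Q y) := by ring
              _ ≤ 2 * η ^ 2 * N ^ 2 * (Q y * (1 / K)) :=
                mul_le_mul_of_nonneg_left this (by positivity)
              _ = _ := by ring
        _ = _ := by rw [← Finset.mul_sum, hQ1, mul_one]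

theorem exp_half_add_le (a b : ℝ) :
    Real.exp ((a + b) / 2) ≤ 1 / 2 * (Real.exp a + Real.exp b) := by
  have h1 : Real.exp a = Real.exp (a / 2) ^ 2 := by rw [← Real.exp_nat_mul]; congr 1; push_cast; ring
  have h2 : Real.exp b = Real.exp (b / 2) ^ 2 := by rw [← Real.exp_nat_mul]; congr 1; push_cast; ring
  rw [add_div, Real.exp_add, h1, h2]
  nlinarith [sq_nonneg (Real.exp (a / 2) - Real.exp (b / 2))]

/-- Variance is paid only in bins with `P ≤ 3 * Q`, and drift is collected only in bins with `P <
Q`. All of these have mass of order `1 / K`, so arbitrarily heavy bins of the unknown law do no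
harm. -/
theorem listMean_exp_neg_binStat_le {P Q : Y → ℝ} (hP : ∀ y, 0 ≤ P y) (hQ : ∀ y, 0 ≤ Q y)
    (hP1 : ∑ y, P y = 1) (hQ1 : ∑ y, Q y = 1) {K η ε : ℝ} (hK : 0 < K)
    (hcard : (Fintype.card Y : ℝ) ≤ 2 * K)
    (hQK : ∀ y, Q y ≤ 1 / K) (hη : 0 ≤ η) (hη1 : η ≤ 1 / 32) (hε : 0 ≤ ε)
    (hPQ : ε ≤ ∑ y, max (Q y - P y) 0) {r N : ℕ} (hr1 : 1 ≤ r)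
    (hr : η * (2 * r : ℕ) ≤ 1 / 8) (hN : η * ((N + N : ℕ) / K) ≤ 1) (hNr : N / K ≤ r) :
    listMean (mixedSymbol P Q) (N + N) (fun l => Real.exp (-η * binStat (2 * r) l)) ≤
      Real.exp (4 * η ^ 2 * (N + N : ℕ) ^ 2 / K - η * (N + N : ℕ) ^ 2 * ε ^ 2 / (4096 * K)) := by
  set π : Y → ℝ := fun y => (P y + Q y) / 2 with hπ
  set θ : Y → ℝ := fun y => (P y - Q y) / (P y + Q y) with hθ
  have hπ0 : ∀ y, 0 ≤ π y := fun y => by have := hP y; have := hQ y; simp only [hπ]; linarith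
  have hπ1 : ∑ y, π y = 1 := by
    simp only [hπ, ← Finset.sum_div, Finset.sum_add_distrib, hP1, hQ1]; norm_num
  have hθ1 : ∀ y, |θ y| ≤ 1 := fun y => by
    rw [hθ, abs_div, abs_of_nonneg (add_nonneg (hP y) (hQ y))]
    refine div_le_one_of_le₀ ?_ (add_nonneg (hP y) (hQ y))
    rw [abs_le]
    constructor <;> linarith [hP y, hQ y]
  have hθsq : ∀ y, θ y ^ 2 ≤ 1 := fun y => (sq_le_one_iff_abs_le_one _).mpr (hθ1 y)
  have hθπ : ∀ y, θ y * π y = (P y - Q y) / 2 := fun y => by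
    rcases (add_nonneg (hP y) (hQ y)).eq_or_lt with h | h
    · have h1 : P y = 0 := by linarith [hP y, hQ y]
      have h2 : Q y = 0 := by linarith [hP y, hQ y]
      simp [hπ, h1, h2]
    · simp only [hθ, hπ]; field_simp
  set A : Y → ℝ := fun y => if P y ≤ 3 * Q y then η ^ 2 else 0 with hA
  set G : Y → ℝ := fun y => if P y < Q y then η * θ y ^ 2 / 8 else 0 with hG
  have hA0 : ∀ y, 0 ≤ A y := fun y => by simp only [hA]; split_ifs <;> positivity
  have hG0 : ∀ y, 0 ≤ G y := fun y => by simp only [hG]; split_ifs <;> positivity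
  have hAG : ∀ y, η ^ 2 / 2 - η * θ y ^ 2 / 16 ≤ (A y - G y) / 2 := fun y => by
    simp only [hA, hG]
    by_cases h1 : P y ≤ 3 * Q y
    · rw [if_pos h1]
      split_ifs
      · linarith
      · have := mul_nonneg hη (sq_nonneg (θ y)); linarith
    · have h2 : ¬ P y < Q y := by have := hQ y; intro h; linarith
      rw [if_neg h1, if_neg h2]
      -- In a heavy bin the drift term already beats the variance term, because `η ≤ 1 / 32`.
      have h3 : 1 / 2 ≤ θ y := by
        rw [hθ, div_le_div_iff₀ (by norm_num) (by linarith [hP y, hQ y])]; linarith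
      have h4 : 1 / 4 ≤ θ y ^ 2 := by nlinarith
      nlinarith
  set X : ℝ := 8 * η ^ 2 * (N + N : ℕ) ^ 2 / K with hX
  set Z : ℝ := η * (N + N : ℕ) ^ 2 * ε ^ 2 / (2048 * K) with hZ
  have hNN : (0 : ℝ) ≤ (N + N : ℕ) := Nat.cast_nonneg _
  have boundA : listMean π (N + N)
      (fun l => Real.exp (∑ y, A y * cappedPairs (2 * r) (l.count y))) ≤ Real.exp X := by
    have hlight : ∀ y, P y ≤ 3 * Q y → π y ≤ 2 * (1 / K) := fun y hy => by
      have := hQK y; simp only [hπ]; linarith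
    refine (listMean_exp_sum_cappedPairs_le hπ0 hπ1 hA0 (N + N) (2 * r) fun y => ?_).trans
      (Real.exp_le_exp.mpr ?_)
    · simp only [hA]
      split_ifs with hy
      · have h1 : η * ((N + N : ℕ) * π y) ≤ 2 := by
          have := mul_le_mul_of_nonneg_left (hlight y hy) (mul_nonneg hη hNN)
          have e : η * ((N + N : ℕ) / K) = η * (N + N : ℕ) * (1 / K) := by ring
          rw [e] at hN
          linarith
        nlinarith [mul_le_mul_of_nonneg_left h1 hη, mul_le_mul_of_nonneg_left hr hη]
      · simp
    · calc ∑ y, 4 * A y * ((N + N : ℕ) * π y) ^ 2 ≤ ∑ y, X * π y := by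
            refine Finset.sum_le_sum fun y _ => ?_
            simp only [hA]
            split_ifs with hy
            · have := mul_le_mul_of_nonneg_left (hlight y hy) (hπ0 y)
              calc 4 * η ^ 2 * ((N + N : ℕ) * π y) ^ 2
                  = 4 * η ^ 2 * (N + N : ℕ) ^ 2 * (π y * π y) := by ring
                _ ≤ 4 * η ^ 2 * (N + N : ℕ) ^ 2 * (π y * (2 * (1 / K))) :=
                  mul_le_mul_of_nonneg_left this (by positivity)
                _ = X * π y := by rw [hX]; ring
            · have : 0 ≤ X := by rw [hX]; positivity
              simpa using mul_nonneg this (hπ0 y)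
        _ = X := by rw [← Finset.mul_sum, hπ1, mul_one]
  have boundG : listMean π (N + N)
      (fun l => Real.exp (-∑ y, G y * cappedPairs (2 * r) (l.count y))) ≤ Real.exp (-Z) := by
    refine (listMean_exp_neg_sum_cappedPairs_le hπ0 hπ1 hG0 N hr1 (fun y => ?_)
      fun y hy => ?_).trans (Real.exp_le_exp.mpr (neg_le_neg ?_))
    · have h1 : G y ≤ η / 8 := by
        simp only [hG]
        split_ifs
        · nlinarith [mul_le_mul_of_nonneg_left (hθsq y) hη]
        · positivity
      push_cast at hr
      nlinarith [mul_le_mul_of_nonneg_right h1 (Nat.cast_nonneg (α := ℝ) r)]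
    · have hlt : P y < Q y := by
        by_contra h
        exact hy (by simp only [hG]; rw [if_neg h])
      have h1 : π y ≤ 1 / K := by have := hQK y; simp only [hπ]; linarith
      calc N * π y ≤ N * (1 / K) := mul_le_mul_of_nonneg_left h1 (Nat.cast_nonneg N)
        _ = N / K := by ring
        _ ≤ r := hNr
    · have e : ∀ y, G y * (N * π y) ^ 2 / 8 =
          η * (N + N : ℕ) ^ 2 / 1024 * (max (Q y - P y) 0) ^ 2 := fun y => by
        simp only [hG]
        split_ifs with hy
        · rw [max_eq_left (by linarith)]
          calc η * θ y ^ 2 / 8 * (N * π y) ^ 2 / 8 = η * N ^ 2 / 64 * (θ y * π y) ^ 2 := by ring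
            _ = _ := by rw [hθπ]; push_cast; ring
        · rw [max_eq_right (by linarith)]; simp
      simp only [e, ← Finset.mul_sum]
      -- Cauchy–Schwarz over at most `2 * K` bins turns the distance `ε` into a squared distance of
      -- at least `ε ^ 2 / (2 * K)`.
      have cs := sq_sum_le_card_mul_sum_sq (s := Finset.univ) (f := fun y => max (Q y - P y) 0)
      rw [Finset.card_univ] at cs
      have h1 : ε ^ 2 ≤ 2 * K * ∑ y, (max (Q y - P y) 0) ^ 2 :=
        (pow_le_pow_left₀ hε hPQ 2).trans (cs.trans (mul_le_mul_of_nonneg_right hcard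
          (Finset.sum_nonneg fun y _ => sq_nonneg _)))
      rw [hZ, div_le_iff₀ (by positivity)]
      calc η * (N + N : ℕ) ^ 2 * ε ^ 2
          ≤ η * (N + N : ℕ) ^ 2 * (2 * K * ∑ y, (max (Q y - P y) 0) ^ 2) :=
            mul_le_mul_of_nonneg_left h1 (by positivity)
        _ = _ := by ring
  -- Negative association needs a common direction of monotonicity, but the `A` part increases and
  -- the `G` part decreases in the counts. The inequality between means separates them; the shift
  -- `(X + Z) / 2` balances the two bounds.
  have hpt : ∀ l : List Y, ∏ y, listMean (biasedBit (θ y)) (l.count y)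
        (fun bs => Real.exp (-η * pairSum (2 * r) bs)) ≤
      1 / 2 * Real.exp (-((X + Z) / 2)) *
          Real.exp (∑ y, A y * cappedPairs (2 * r) (l.count y)) +
        1 / 2 * Real.exp ((X + Z) / 2) *
          Real.exp (-∑ y, G y * cappedPairs (2 * r) (l.count y)) := fun l => by
    calc ∏ y, listMean (biasedBit (θ y)) (l.count y)
          (fun bs => Real.exp (-η * pairSum (2 * r) bs))
        ≤ ∏ y, Real.exp ((A y - G y) / 2 * cappedPairs (2 * r) (l.count y)) :=
          Finset.prod_le_prod
            (fun y _ => listMean_nonneg (biasedBit_nonneg (hθ1 y)) fun _ => (Real.exp_pos _).le)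
            fun y _ => (listMean_exp_neg_pairSum_le (hθ1 y) hη hr _).trans
              (Real.exp_le_exp.mpr (mul_le_mul_of_nonneg_right (hAG y) (cappedPairs_nonneg _ _)))
      _ = Real.exp (((-((X + Z) / 2) + ∑ y, A y * cappedPairs (2 * r) (l.count y)) +
            ((X + Z) / 2 + -∑ y, G y * cappedPairs (2 * r) (l.count y))) / 2) := by
          rw [← Real.exp_sum]
          congr 1
          rw [show ∀ a b c : ℝ, ((-a + b) + (a + -c)) / 2 = (b - c) / 2 by intros; ring,
            ← Finset.sum_sub_distrib, Finset.sum_div]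
          exact Finset.sum_congr rfl fun y _ => by ring
      _ ≤ _ := by
          refine (exp_half_add_le _ _).trans_eq ?_
          rw [Real.exp_add, Real.exp_add]
          ring
  rw [listMean_exp_binStat hP hQ]
  refine (listMean_mono hπ0 fun l _ => hpt l).trans ?_
  rw [listMean_add, listMean_const_mul, listMean_const_mul]
  calc _ ≤ 1 / 2 * Real.exp (-((X + Z) / 2)) * Real.exp X +
        1 / 2 * Real.exp ((X + Z) / 2) * Real.exp (-Z) :=
        add_le_add (mul_le_mul_of_nonneg_left boundA (by positivity))
          (mul_le_mul_of_nonneg_left boundG (by positivity))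
    _ = Real.exp ((X - Z) / 2) := by
        rw [mul_assoc, mul_assoc, ← Real.exp_add, ← Real.exp_add,
          show -((X + Z) / 2) + X = (X - Z) / 2 by ring,
          show (X + Z) / 2 + -Z = (X - Z) / 2 by ring]
        ring
    _ = _ := by congr 1; rw [hX, hZ]; field_simp; ring

end Bins

/-! ### Finite probability mass functions -/

section FinitePMF

variable {α β ι : Type}

theorem toReal_bind_apply [Fintype α] (p : PMF α) (g : α → PMF β) (b : β) :
    ((p.bind g) b).toReal = ∑ a, (p a).toReal * (g a b).toReal := by
  rw [PMF.bind_apply, tsum_fintype, ENNReal.toReal_sum fun a _ =>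
    ENNReal.mul_ne_top (p.apply_ne_top a) ((g a).apply_ne_top b)]
  simp only [ENNReal.toReal_mul]

theorem sum_toReal_eq_one [Fintype α] (p : PMF α) : ∑ a, (p a).toReal = 1 := by
  rw [← ENNReal.toReal_sum fun a _ => p.apply_ne_top a, (tsum_fintype _).symm.trans p.tsum_coe,
    ENNReal.toReal_one]

theorem toReal_pure_apply [DecidableEq α] (a b : α) :
    ((PMF.pure a) b).toReal = if b = a then 1 else 0 := by
  rw [PMF.pure_apply]
  split_ifs <;> simp

theorem toReal_uniformOfFintype_apply [Fintype α] [Nonempty α] (a : α) :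
    ((PMF.uniformOfFintype α) a).toReal = 1 / Fintype.card α := by
  simp

theorem indepLaw_apply [Fintype ι] [Fintype α] (P : ι → PMF α) (f : ι → α) :
    indepLaw P f = ∏ i, P i (f i) := rfl

theorem indepLaw_bind_indepLaw [Fintype ι] [Fintype α] [Fintype β] (P : ι → PMF α)
    (κ : ι → α → PMF β) :
    ((indepLaw P).bind fun X => indepLaw fun i => κ i (X i)) =
      indepLaw fun i => (P i).bind (κ i) := by
  classical
  ext f
  rw [PMF.bind_apply, tsum_fintype]
  simp only [indepLaw_apply, PMF.bind_apply, tsum_fintype, ← Finset.prod_mul_distrib]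
  rw [Finset.prod_univ_sum, Fintype.piFinset_univ]

theorem toReal_iidLaw_bind_apply [Fintype α] (p : PMF α) (N : ℕ) (g : (Fin N → α) → PMF β)
    (b : β) (F : List α → ℝ) (hF : ∀ f, ((g f) b).toReal = F (List.ofFn f)) :
    (((iidLaw p (Fin N)).bind g) b).toReal = listMean (fun a => (p a).toReal) N F := by
  rw [toReal_bind_apply, ← sum_prod_mul_ofFn]
  refine Finset.sum_congr rfl fun f _ => ?_
  rw [hF, iidLaw, indepLaw_apply, ENNReal.toReal_prod]

end FinitePMF

/-- The one-sided form is needed because the drift is collected only where `p` is below `q`. -/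
theorem tvDist_eq_sum_max {k : ℕ} (p q : PMF (Fin k)) :
    tvDist p q = ∑ x, max ((q x).toReal - (p x).toReal) 0 := by
  have h : ∀ x, max ((q x).toReal - (p x).toReal) 0 =
      (1 / 2) * |(p x).toReal - (q x).toReal| + (1 / 2) * ((q x).toReal - (p x).toReal) :=
    fun x => by
      rcases le_total (q x).toReal (p x).toReal with h | h
      · rw [max_eq_right (by linarith), abs_of_nonneg (by linarith)]; ring
      · rw [max_eq_left (by linarith), abs_of_nonpos (by linarith)]; ring
  simp only [h, Finset.sum_add_distrib, ← Finset.mul_sum, Finset.sum_sub_distrib,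
    sum_toReal_eq_one, tvDist]
  ring

/-! ### The centralized test -/

section CentralizedTest

variable {k : ℕ}

/-- The bins of a domain whose element `x` is split into `b x + 1` bins. -/
abbrev SplitBin (b : Fin k → ℕ) : Type := Σ x : Fin k, Fin (b x + 1)

/-- A random bin of the element `x`. -/
def splitSymbol (b : Fin k → ℕ) (x : Fin k) : PMF (SplitBin b) :=
  (PMF.uniformOfFintype (Fin (b x + 1))).bind fun i => PMF.pure ⟨x, i⟩

theorem toReal_bind_splitSymbol (b : Fin k → ℕ) (p : PMF (Fin k)) (y : SplitBin b) :
    ((p.bind (splitSymbol b)) y).toReal = (p y.1).toReal / (b y.1 + 1) := by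
  classical
  rw [toReal_bind_apply]
  have h : ∀ x, (p x).toReal * ((splitSymbol b x) y).toReal =
      ∑ i : Fin (b x + 1), if y = (⟨x, i⟩ : SplitBin b) then
        (p x).toReal / (b x + 1) else 0 := fun x => by
    rw [splitSymbol, toReal_bind_apply, Finset.mul_sum]
    refine Finset.sum_congr rfl fun i _ => ?_
    rw [toReal_uniformOfFintype_apply, toReal_pure_apply]
    split_ifs <;> simp [div_eq_mul_inv]
  simp only [h]
  rw [← Fintype.sum_sigma (fun a : SplitBin b =>
    if y = a then (p a.1).toReal / (b a.1 + 1) else 0), Finset.sum_ite_eq]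
  simp

/-- A fair coin decides between a random bin of the sample `x`, with the bit `true`, and a bin
drawn from the reference law `Q`, with the bit `false`. -/
def mixedChannel (b : Fin k → ℕ) (Q : PMF (SplitBin b)) (x : Fin k) : PMF (SplitBin b × Bool) :=
  (PMF.uniformOfFintype Bool).bind fun c =>
    if c then (splitSymbol b x).bind fun y => PMF.pure (y, true)
    else Q.bind fun y => PMF.pure (y, false)

theorem toReal_bind_pure_prod {α : Type} [Fintype α] [DecidableEq α] (m : PMF α) (c : Bool)
    (a : α × Bool) :
    ((m.bind fun y => PMF.pure (y, c)) a).toReal = if a.2 = c then (m a.1).toReal else 0 := by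
  obtain ⟨y, b⟩ := a
  rw [toReal_bind_apply]
  simp only [toReal_pure_apply, Prod.mk.injEq]
  by_cases h : b = c <;> simp [h]

theorem toReal_bind_mixedChannel (b : Fin k → ℕ) (Q : PMF (SplitBin b)) (p : PMF (Fin k)) :
    (fun a => ((p.bind (mixedChannel b Q)) a).toReal) =
      mixedSymbol (fun y => ((p.bind (splitSymbol b)) y).toReal) (fun y => (Q y).toReal) := by
  classical
  funext a
  have h : ∀ x, ((mixedChannel b Q x) a).toReal =
      (if a.2 then ((splitSymbol b x) a.1).toReal else (Q a.1).toReal) / 2 := fun x => by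
    rw [mixedChannel, toReal_bind_apply]
    simp only [Fintype.sum_bool, toReal_uniformOfFintype_apply, if_true, Bool.false_eq_true,
      if_false, toReal_bind_pure_prod, Fintype.card_bool]
    cases a.2 <;> simp <;> ring
  rw [toReal_bind_apply]
  simp only [h, mixedSymbol, toReal_bind_apply]
  cases a.2
  · simp only [Bool.false_eq_true, if_false, ← Finset.sum_mul, sum_toReal_eq_one, one_mul]
  · simp only [if_true, Finset.sum_div, mul_div_assoc]

/-- The test which accepts if the pair statistic of the randomized bins is below `z`. -/
def pairTest (b : Fin k → ℕ) (Q : PMF (SplitBin b)) (r N : ℕ) (z : ℝ) (X : Fin N → Fin k) :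
    PMF Bool :=
  (indepLaw fun i => mixedChannel b Q (X i)).bind fun w =>
    PMF.pure (decide (binStat r (List.ofFn w) < z))

theorem toReal_iidLaw_bind_pairTest (b : Fin k → ℕ) (Q : PMF (SplitBin b)) (r N : ℕ) (z : ℝ)
    (p : PMF (Fin k)) (v : Bool) :
    (((iidLaw p (Fin N)).bind (pairTest b Q r N z)) v).toReal =
      listMean (mixedSymbol (fun y => ((p.bind (splitSymbol b)) y).toReal)
        fun y => (Q y).toReal) N
        (fun l => if v = decide (binStat r l < z) then 1 else 0) := by
  have h : (iidLaw p (Fin N)).bind (pairTest b Q r N z) =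
      (iidLaw (p.bind (mixedChannel b Q)) (Fin N)).bind fun w =>
        PMF.pure (decide (binStat r (List.ofFn w) < z)) := by
    rw [iidLaw, iidLaw, ← indepLaw_bind_indepLaw, PMF.bind_bind]
    rfl
  rw [h, ← toReal_bind_mixedChannel]
  exact toReal_iidLaw_bind_apply _ _ _ _ _ fun f => toReal_pure_apply _ _

/-- Chernoff's bound in the form used for both errors: `c * G` dominates the indicator of the wrong
decision. -/
theorem one_sub_le_listMean {α : Type} [Fintype α] {P : α → ℝ} (hP : ∀ a, 0 ≤ P a)
    (hP1 : ∑ a, P a = 1) {N : ℕ} {F G : List α → ℝ} {c d : ℝ} (h : ∀ l, 1 - c * G l ≤ F l)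
    (hc : 0 ≤ c) (hG : listMean P N G ≤ d) : 1 - c * d ≤ listMean P N F := by
  have h1 := listMean_mono hP (n := N) fun l (_ : l.length = N) =>
    show 1 + (-c) * G l ≤ F l by have := h l; linarith
  rw [listMean_add, listMean_const_mul, listMean_const hP1] at h1
  have := mul_le_mul_of_nonneg_left hG hc
  linarith

theorem exists_test_of_sampleSize (q : PMF (Fin k)) {K N r : ℕ} {ε L : ℝ} (hK : 1 ≤ K)
    (hkK : k ≤ K) (hε : 0 < ε) (hε1 : ε ≤ 1) (hr1 : 1 ≤ r)
    (hr : ε ^ 2 * r ≤ 2 ^ 12) (hNr : (N : ℝ) / K ≤ r)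
    (hL : 2 ^ 30 * K * L ≤ ((N + N : ℕ) : ℝ) ^ 2 * ε ^ 4) :
    ∃ e : (Fin (N + N) → Fin k) → PMF Bool,
      1 - Real.exp (-L) ≤ (((iidLaw q (Fin (N + N))).bind e) true).toReal ∧
      ∀ p : PMF (Fin k), ε < tvDist p q →
        1 - Real.exp (-L) ≤ (((iidLaw p (Fin (N + N))).bind e) false).toReal := by
  classical
  have hKp : (0 : ℝ) < K := by exact_mod_cast hK
  set b : Fin k → ℕ := fun x => ⌊K * (q x).toReal⌋₊ with hb
  set Q : PMF (SplitBin b) := q.bind (splitSymbol b) with hQ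
  set η : ℝ := ε ^ 2 / 2 ^ 16 with hη
  -- Half of the guaranteed drift. With this `η`, the variance terms cost at most half of `η * z`,
  -- so both exponents are at most `-(N + N) ^ 2 * ε ^ 4 / (2 ^ 30 * K)`.
  set z : ℝ := ((N + N : ℕ) : ℝ) ^ 2 * ε ^ 2 / (8192 * K) with hz
  have hη0 : 0 ≤ η := by positivity
  have hε2 : ε ^ 2 ≤ 1 := pow_le_one₀ hε.le hε1
  have hη1 : η ≤ 1 / 32 := by rw [hη]; linarith
  have hηr : η * (2 * r : ℕ) ≤ 1 / 8 := by rw [hη]; push_cast; linarith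
  have hηN : η * ((N + N : ℕ) / K) ≤ 1 := by
    have h1 : ((N + N : ℕ) : ℝ) / K ≤ (2 * r : ℕ) := by push_cast; rw [add_div]; linarith
    linarith [mul_le_mul_of_nonneg_left h1 hη0]
  have hQ0 : ∀ y, 0 ≤ (Q y).toReal := fun y => ENNReal.toReal_nonneg
  have hQK : ∀ y, (Q y).toReal ≤ 1 / K := fun y => by
    rw [hQ, toReal_bind_splitSymbol, div_le_div_iff₀ (by positivity) hKp, one_mul, mul_comm]
    exact (Nat.lt_floor_add_one _).le
  have hcard : (Fintype.card (SplitBin b) : ℝ) ≤ 2 * K := by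
    rw [Fintype.card_sigma]
    simp only [Fintype.card_fin]
    push_cast
    rw [Finset.sum_add_distrib]
    have h1 : ∑ x, (b x : ℝ) ≤ ∑ x, K * (q x).toReal :=
      Finset.sum_le_sum fun x _ => Nat.floor_le (by positivity)
    rw [← Finset.mul_sum, sum_toReal_eq_one, mul_one] at h1
    have h2 : (k : ℝ) ≤ K := by exact_mod_cast hkK
    simp only [Finset.sum_const, Finset.card_univ, Fintype.card_fin, nsmul_eq_mul, mul_one]
    linarith
  have hW0 : ∀ p : PMF (Fin k), ∀ a, 0 ≤ mixedSymbol
      (fun y => ((p.bind (splitSymbol b)) y).toReal) (fun y => (Q y).toReal) a := fun p a => by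
    rw [← toReal_bind_mixedChannel]; exact ENNReal.toReal_nonneg
  have hW1 : ∀ p : PMF (Fin k), ∑ a, mixedSymbol
      (fun y => ((p.bind (splitSymbol b)) y).toReal) (fun y => (Q y).toReal) a = 1 := fun p => by
    rw [← toReal_bind_mixedChannel]; exact sum_toReal_eq_one _
  have hLd : L ≤ ((N + N : ℕ) : ℝ) ^ 2 * ε ^ 4 / (2 ^ 30 * K) := by
    rw [le_div_iff₀ (by positivity)]; linarith
  refine ⟨pairTest b Q (2 * r) (N + N) z, ?_, fun p hp => ?_⟩
  · rw [toReal_iidLaw_bind_pairTest]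
    refine le_trans ?_ (one_sub_le_listMean (hW0 q) (hW1 q)
      (G := fun l => Real.exp (η * binStat (2 * r) l)) (c := Real.exp (-(η * z))) (fun l => ?_)
      (Real.exp_pos _).le (listMean_exp_binStat_self_le hQ0 (sum_toReal_eq_one Q) hQK hη0 hη1
        hηr hηN))
    · rw [← Real.exp_add]
      refine sub_le_sub_left (Real.exp_le_exp.mpr ?_) 1
      have e : -(η * z) + 2 * η ^ 2 * (N + N : ℕ) ^ 2 / K =
          -(((N + N : ℕ) : ℝ) ^ 2 * ε ^ 4 / (2 ^ 30 * K)) -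
            ((N + N : ℕ) : ℝ) ^ 2 * ε ^ 4 / (2 ^ 31 * K) := by
        rw [hη, hz]; field_simp; ring
      have : 0 ≤ ((N + N : ℕ) : ℝ) ^ 2 * ε ^ 4 / (2 ^ 31 * K) := by positivity
      rw [e]; linarith
    · rw [← Real.exp_add]
      by_cases h : binStat (2 * r) l < z
      · simp [h, (Real.exp_pos _).le]
      · have h1 : 0 ≤ -(η * z) + η * binStat (2 * r) l := by
          have := mul_le_mul_of_nonneg_left (not_lt.mp h) hη0; linarith
        simpa [h] using h1
  · set P : SplitBin b → ℝ := fun y => ((p.bind (splitSymbol b)) y).toReal with hP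
    -- Splitting preserves total variation: an element's difference is shared equally among its
    -- bins.
    have hPQ : ε ≤ ∑ y, max ((Q y).toReal - P y) 0 := by
      rw [tvDist_eq_sum_max] at hp
      rw [Fintype.sum_sigma]
      refine hp.le.trans_eq (Finset.sum_congr rfl fun x _ => ?_)
      simp only [hP, hQ, toReal_bind_splitSymbol]
      rw [Finset.sum_const, Finset.card_univ, Fintype.card_fin, nsmul_eq_mul, ← sub_div]
      have hbp : (0 : ℝ) < b x + 1 := by positivity
      have e := max_div_div_right hbp.le ((q x).toReal - (p x).toReal) 0
      rw [zero_div] at e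
      rw [e]
      push_cast
      field_simp
    rw [toReal_iidLaw_bind_pairTest]
    refine le_trans ?_ (one_sub_le_listMean (hW0 p) (hW1 p)
      (G := fun l => Real.exp (-η * binStat (2 * r) l)) (c := Real.exp (η * z)) (fun l => ?_)
      (Real.exp_pos _).le (listMean_exp_neg_binStat_le (fun _ => ENNReal.toReal_nonneg) hQ0
        (sum_toReal_eq_one _) (sum_toReal_eq_one Q) hKp hcard hQK hη0 hη1 hε.le hPQ hr1 hηr hηN
        hNr))
    · rw [← Real.exp_add]
      refine sub_le_sub_left (Real.exp_le_exp.mpr ?_) 1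
      have e : η * z + (4 * η ^ 2 * (N + N : ℕ) ^ 2 / K -
          η * (N + N : ℕ) ^ 2 * ε ^ 2 / (4096 * K)) =
          -(((N + N : ℕ) : ℝ) ^ 2 * ε ^ 4 / (2 ^ 30 * K)) := by
        rw [hη, hz]; field_simp; ring
      rw [e]; linarith
    · rw [← Real.exp_add]
      by_cases h : binStat (2 * r) l < z
      · have h1 : 0 ≤ η * z + -η * binStat (2 * r) l := by
          have := mul_le_mul_of_nonneg_left h.le hη0; linarith
        simpa [h] using h1
      · simp [h, (Real.exp_pos _).le]

end CentralizedTest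

/-! ### Independent blocks -/

section Blocks

variable {α β ι κ : Type}

theorem indepLaw_pure [Fintype ι] [Fintype α] (f : ι → α) :
    (indepLaw fun i => PMF.pure (f i)) = PMF.pure f := by
  classical
  ext g
  simp only [indepLaw_apply, PMF.pure_apply]
  by_cases h : g = f
  · simp [h]
  · rw [if_neg h]
    obtain ⟨i, hi⟩ := Function.ne_iff.mp h
    exact Finset.prod_eq_zero (Finset.mem_univ i) (if_neg hi)

/-- Independent players grouped into blocks give independent, identically distributed block
outcomes. -/
theorem indepLaw_prod_bind [Fintype ι] [Fintype κ] [Fintype α] [Fintype β] {γ : Type}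
    (P : κ → PMF α) (f : (κ → α) → β) (g : (ι → β) → PMF γ) :
    ((indepLaw fun t : ι × κ => P t.2).bind fun w => g fun b => f fun t => w (b, t)) =
      (iidLaw ((indepLaw P).bind fun u => PMF.pure (f u)) ι).bind g := by
  classical
  have h : iidLaw ((indepLaw P).bind fun u => PMF.pure (f u)) ι =
      (indepLaw fun _ : ι => indepLaw P).bind fun W => PMF.pure fun b => f (W b) := by
    rw [iidLaw, ← indepLaw_bind_indepLaw]
    simp only [indepLaw_pure]
  rw [h, PMF.bind_bind]
  simp only [PMF.pure_bind]
  ext v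
  rw [PMF.bind_apply, PMF.bind_apply, ← (Equiv.curry ι κ α).tsum_eq]
  refine tsum_congr fun w => ?_
  simp only [indepLaw_apply, Fintype.prod_prod_type, Equiv.curry_apply]
  rfl

end Blocks

/-! ### Thinned samples -/

section Thinning

variable {α : Type} [Fintype α]

/-- The value of `g` at the first `N` entries of a list; zero if the list is shorter. -/
def prefixValue (N : ℕ) (g : List α → ℝ) (l : List α) : ℝ :=
  if N ≤ l.length then g (l.take N) else 0

/-- The probability of at least `N` successes in `B` trials of success probability `A`. -/
def atLeastProb (A : ℝ) : ℕ → ℕ → ℝ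
  | _, 0 => 1
  | 0, _ + 1 => 0
  | B + 1, N + 1 => (1 - A) * atLeastProb A B (N + 1) + A * atLeastProb A B N

/-- Markov's inequality for `2 ^ (-S)`, where `S` is the number of successes: its mean is `(1 - A /
2) ^ B`. -/
theorem le_atLeastProb {A : ℝ} (h0 : 0 ≤ A) (h1 : A ≤ 1) (B N : ℕ) :
    1 - 2 ^ N * (1 - A / 2) ^ B ≤ atLeastProb A B N := by
  have hA : 0 ≤ 1 - A / 2 := by linarith
  induction B generalizing N with
  | zero =>
    cases N with
    | zero => simp [atLeastProb]
    | succ N =>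
      have : (1 : ℝ) ≤ 2 ^ (N + 1) := one_le_pow₀ (by norm_num)
      simp only [atLeastProb, pow_zero]; linarith
  | succ B ih =>
    cases N with
    | zero =>
      have := pow_nonneg hA (B + 1)
      simp only [atLeastProb, pow_zero]; linarith
    | succ N =>
      have a := mul_le_mul_of_nonneg_left (ih (N + 1)) (by linarith : 0 ≤ 1 - A)
      have b := mul_le_mul_of_nonneg_left (ih N) h0
      simp only [atLeastProb]
      have e : (2 : ℝ) ^ (N + 1) * (1 - A / 2) ^ (B + 1) =
          (1 - A) * (2 ^ (N + 1) * (1 - A / 2) ^ B) + A * (2 ^ N * (1 - A / 2) ^ B) := by ring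
      rw [e]; linarith

/-- The pattern of aborts is independent of the returned symbols, so the probability of enough
successes factors out exactly. -/
theorem listMean_prefixValue_reduceOption {ν : Option α → ℝ} {P : α → ℝ} {A : ℝ}
    (hν : ∀ x, ν (some x) = A * P x) (hν0 : ν none = 1 - A) (hP : ∑ x, P x = 1) (B N : ℕ)
    (g : List α → ℝ) :
    listMean ν B (fun o => prefixValue N g o.reduceOption) =
      atLeastProb A B N * listMean P N g := by
  have hν1 : ∑ o, ν o = 1 := by
    rw [Fintype.sum_option, hν0]
    simp only [hν, ← Finset.mul_sum, hP]
    ring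
  induction B generalizing N g with
  | zero => cases N <;> simp [listMean, atLeastProb, prefixValue, List.reduceOption]
  | succ B ih =>
    cases N with
    | zero => simpa [prefixValue, atLeastProb, listMean] using listMean_const hν1 (B + 1) (g [])
    | succ N =>
      have hs : ∀ x, (fun o : List (Option α) =>
          prefixValue (N + 1) g (some x :: o).reduceOption) =
          fun o => prefixValue N (fun l => g (x :: l)) o.reduceOption := fun x => by
        funext o
        simp [prefixValue, List.reduceOption_cons_of_some]
      have h0 : (fun o : List (Option α) =>
          prefixValue (N + 1) g (none :: o).reduceOption) =
          fun o => prefixValue (N + 1) g o.reduceOption := by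
        funext o
        simp [List.reduceOption_cons_of_none]
      rw [listMean, Fintype.sum_option]
      simp only [hs, h0, ih, hν, hν0]
      rw [atLeastProb, add_mul, mul_assoc, mul_assoc, listMean]
      congr 1
      rw [Finset.mul_sum, Finset.mul_sum]
      exact Finset.sum_congr rfl fun x _ => by ring

end Thinning

/-! ### The outcome of a simulation block -/

section Block

variable {k ℓ : ℕ}

theorem one_le_partSize (hℓ : 1 ≤ ℓ) : 1 ≤ 2 ^ ℓ - 1 := by
  have : 2 ^ 1 ≤ 2 ^ ℓ := Nat.pow_le_pow_right (by norm_num) hℓ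
  omega

theorem position_lt (hℓ : 1 ≤ ℓ) (x : ℕ) : x % (2 ^ ℓ - 1) + 1 < 2 ^ ℓ := by
  have h := one_le_partSize hℓ
  have := Nat.mod_lt x h
  omega

theorem eq_of_testBit_eq_below {a b : ℕ} (ha : a < 2 ^ ℓ) (hb : b < 2 ^ ℓ)
    (h : ∀ i : Fin ℓ, a.testBit i = b.testBit i) : a = b := by
  refine Nat.eq_of_testBit_eq fun i => ?_
  rcases lt_or_ge i ℓ with hi | hi
  · exact h ⟨i, hi⟩
  · have hp : 2 ^ ℓ ≤ 2 ^ i := Nat.pow_le_pow_right (by norm_num) hi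
    rw [Nat.testBit_lt_two_pow (ha.trans_le hp), Nat.testBit_lt_two_pow (hb.trans_le hp)]

theorem symbolCode_ne_zeroMessage (hℓ : 1 ≤ ℓ) (x : Fin k) :
    symbolCode ℓ x ≠ zeroMessage ℓ := fun h => by
  have := eq_of_testBit_eq_below (b := 0) (position_lt hℓ x) (by positivity) fun i => by
    simpa [symbolCode, zeroMessage] using congrFun h i
  omega

theorem eq_of_symbolCode_eq (hℓ : 1 ≤ ℓ) {x y : Fin k} {j : Fin (numParts k ℓ)}
    (hx : InPart ℓ x j) (hy : InPart ℓ y j) (h : symbolCode ℓ x = symbolCode ℓ y) : x = y := by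
  have h1 := eq_of_testBit_eq_below (position_lt hℓ x) (position_lt hℓ y) fun i => congrFun h i
  have h2 : (x : ℕ) / (2 ^ ℓ - 1) = y / (2 ^ ℓ - 1) := hx.trans hy.symm
  apply Fin.ext
  rw [← Nat.div_add_mod (x : ℕ) (2 ^ ℓ - 1), ← Nat.div_add_mod (y : ℕ) (2 ^ ℓ - 1), h2]
  omega

theorem exists_inPart (hℓ : 1 ≤ ℓ) (x : Fin k) : ∃ j : Fin (numParts k ℓ), InPart ℓ x j := by
  refine ⟨⟨(x : ℕ) / (2 ^ ℓ - 1), ?_⟩, rfl⟩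
  have h := one_le_partSize hℓ
  rw [Nat.div_lt_iff_lt_mul h]
  refine x.isLt.trans_le ?_
  have := le_smul_ceilDiv (b := k) (show 0 < 2 ^ ℓ - 1 from h)
  rwa [smul_eq_mul, mul_comm] at this

theorem Produces.eq (hℓ : 1 ≤ ℓ) {w : BlockPlayer k ℓ → Message ℓ} {x y : Fin k}
    (hx : Produces w x) (hy : Produces w y) : x = y := by
  obtain ⟨h, j, h1, -, h3, h4⟩ := hx
  obtain ⟨h', j', h1', -, h3', h4'⟩ := hy
  obtain ⟨rfl, rfl⟩ := (h1' h j).mp ((h1 h j).mpr ⟨rfl, rfl⟩)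
  exact eq_of_symbolCode_eq hℓ h3 h3' (h4.symm.trans h4')

theorem blockOutcome_eq_some_iff (hℓ : 1 ≤ ℓ) (w : BlockPlayer k ℓ → Message ℓ) (x : Fin k) :
    some x = blockOutcome w ↔ Produces w x := by
  unfold blockOutcome
  constructor
  · intro h
    split_ifs at h with h'
    · exact (Option.some.inj h) ▸ h'.choose_spec
  · intro h
    rw [dif_pos ⟨x, h⟩]
    exact congrArg some (Produces.eq hℓ h (Exists.choose_spec (⟨x, h⟩ : ∃ x, Produces w x)))

/-- The law of the flipped message of a player who watches the part `j`. -/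
def flippedLaw (ℓ : ℕ) (p : PMF (Fin k)) (j : Fin (numParts k ℓ)) : PMF (Message ℓ) :=
  p.bind fun x => flipMessage (playerMessage ℓ j x)

open scoped Classical in
/-- The probability that the flipped message of a player who watches the part `j` is nonzero. -/
def activeProb (ℓ : ℕ) (p : PMF (Fin k)) (j : Fin (numParts k ℓ)) : ℝ :=
  ∑ x, if InPart ℓ x j then (p x).toReal / 2 else 0

theorem toReal_flipMessage_apply (w m : Message ℓ) :
    ((flipMessage w) m).toReal =
      (if m = w then 1 / 2 else 0) + if m = zeroMessage ℓ then 1 / 2 else 0 := by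
  have h : flipMessage w = (PMF.uniformOfFintype Bool).bind fun c =>
      PMF.pure (if c then w else zeroMessage ℓ) := rfl
  rw [h, toReal_bind_apply]
  simp only [Fintype.sum_bool, toReal_uniformOfFintype_apply, toReal_pure_apply,
    Fintype.card_bool, if_true, Bool.false_eq_true, if_false, mul_ite, mul_one, mul_zero,
    Nat.cast_ofNat]

theorem toReal_flippedLaw_zeroMessage (hℓ : 1 ≤ ℓ) (p : PMF (Fin k))
    (j : Fin (numParts k ℓ)) :
    ((flippedLaw ℓ p j) (zeroMessage ℓ)).toReal = 1 - activeProb ℓ p j := by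
  classical
  rw [flippedLaw, toReal_bind_apply, activeProb, ← sum_toReal_eq_one p,
    ← Finset.sum_sub_distrib]
  refine Finset.sum_congr rfl fun x _ => ?_
  rw [toReal_flipMessage_apply, if_pos rfl, playerMessage]
  by_cases h : InPart ℓ x j
  · rw [if_pos h, if_pos h, if_neg (symbolCode_ne_zeroMessage hℓ x).symm]; ring
  · rw [if_neg h, if_neg h, if_pos rfl]; ring

theorem toReal_flippedLaw_symbolCode (hℓ : 1 ≤ ℓ) (p : PMF (Fin k))
    {j : Fin (numParts k ℓ)} {x : Fin k} (hx : InPart ℓ x j) :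
    ((flippedLaw ℓ p j) (symbolCode ℓ x)).toReal = (p x).toReal / 2 := by
  classical
  rw [flippedLaw, toReal_bind_apply, Finset.sum_eq_single x]
  · rw [toReal_flipMessage_apply, playerMessage, if_pos hx, if_pos rfl,
      if_neg (symbolCode_ne_zeroMessage hℓ x)]
    ring
  · intro y _ hyx
    rw [toReal_flipMessage_apply, if_neg (symbolCode_ne_zeroMessage hℓ x), if_neg]
    · ring
    · intro h
      rw [playerMessage] at h
      split_ifs at h with hy
      · exact hyx (eq_of_symbolCode_eq hℓ hy hx h.symm)
      · exact symbolCode_ne_zeroMessage hℓ x h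
  · exact fun h => absurd (Finset.mem_univ x) h

/-- The law of the outcome of a block. -/
def blockLaw (ℓ : ℕ) (p : PMF (Fin k)) : PMF (Option (Fin k)) :=
  (indepLaw fun t : BlockPlayer k ℓ => flippedLaw ℓ p t.2.1).bind fun w =>
    PMF.pure (blockOutcome w)

/-- The probability that a block does not abort. -/
def blockSuccess (ℓ : ℕ) (p : PMF (Fin k)) : ℝ := (∏ j, (1 - activeProb ℓ p j)) ^ 2

/-- The message `m` of the player `t` is compatible with a block that produces `x` from the
message of the player `(s, 0)`. -/
def Compatible (x : Fin k) (s : Fin 2 × Fin (numParts k ℓ)) (t : BlockPlayer k ℓ)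
    (m : Message ℓ) : Prop :=
  if t.2.2 = 0 then m = if (t.1, t.2.1) = s then symbolCode ℓ x else zeroMessage ℓ
  else (t.1, t.2.1) = s → m = zeroMessage ℓ

theorem produces_iff (hℓ : 1 ≤ ℓ) {x : Fin k} {j : Fin (numParts k ℓ)} (hx : InPart ℓ x j)
    (w : BlockPlayer k ℓ → Message ℓ) :
    Produces w x ↔ ∃ h : Fin 2, ∀ t, Compatible x (h, j) t (w t) := by
  constructor
  · rintro ⟨h, j', h1, h2, h3, h4⟩
    obtain rfl : j' = j := Fin.ext (h3.symm.trans hx)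
    refine ⟨h, ?_⟩
    rintro ⟨a, b, c⟩
    by_cases hab : a = h ∧ b = j'
    · obtain ⟨rfl, rfl⟩ := hab
      fin_cases c
      · simpa [Compatible] using h4
      · simpa [Compatible] using h2
    · have h5 : w (a, b, 0) = zeroMessage ℓ := by
        by_contra h6
        exact hab ((h1 a b).mp h6)
      fin_cases c
      · simpa [Compatible, hab] using h5
      · simp [Compatible, hab]
  · rintro ⟨h, hc⟩
    have h4 : w (h, j, 0) = symbolCode ℓ x := by simpa [Compatible] using hc (h, j, 0)
    refine ⟨h, j, fun a b => ?_, by simpa [Compatible] using hc (h, j, 1), hx, h4⟩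
    constructor
    · intro hw
      by_contra hab
      exact hw (by simpa [Compatible, hab] using hc (a, b, 0))
    · rintro ⟨rfl, rfl⟩
      rw [h4]
      exact symbolCode_ne_zeroMessage hℓ x

theorem compatible_unique (hℓ : 1 ≤ ℓ) {x : Fin k} {j : Fin (numParts k ℓ)}
    {w : BlockPlayer k ℓ → Message ℓ} {h h' : Fin 2} (hc : ∀ t, Compatible x (h, j) t (w t))
    (hc' : ∀ t, Compatible x (h', j) t (w t)) : h = h' := by
  by_contra hne
  have h1 : w (h, j, 0) = symbolCode ℓ x := by simpa [Compatible] using hc (h, j, 0)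
  have h2 : w (h, j, 0) = zeroMessage ℓ := by simpa [Compatible, hne] using hc' (h, j, 0)
  exact symbolCode_ne_zeroMessage hℓ x (h1.symm.trans h2)

-- Every odd-even pair contributes `1 - activeProb`: through the even player if the pair is
-- selected, and through the odd player otherwise, when the even player is unconstrained.
open scoped Classical in
theorem sum_compatible (hℓ : 1 ≤ ℓ) (p : PMF (Fin k)) {x : Fin k} {j : Fin (numParts k ℓ)}
    (hx : InPart ℓ x j) (h a : Fin 2) (b : Fin (numParts k ℓ)) :
    ∏ c : Fin 2, ∑ m, (if Compatible x (h, j) (a, b, c) m then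
        ((flippedLaw ℓ p b) m).toReal else 0) =
      (1 - activeProb ℓ p b) * if (a, b) = (h, j) then (p x).toReal / 2 else 1 := by
  rw [Fin.prod_univ_two]
  by_cases hs : (a, b) = (h, j)
  · obtain ⟨rfl, rfl⟩ := Prod.mk.inj hs
    simp only [Compatible, if_true, one_ne_zero, if_false, forall_const, Finset.sum_ite_eq',
      Finset.mem_univ, toReal_flippedLaw_zeroMessage hℓ,
      toReal_flippedLaw_symbolCode hℓ p hx]
    ring
  · simp only [Compatible, if_true, one_ne_zero, if_false, hs, Finset.sum_ite_eq',
      Finset.mem_univ, toReal_flippedLaw_zeroMessage hℓ, false_imp_iff,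
      sum_toReal_eq_one]

theorem toReal_blockLaw_some (hℓ : 1 ≤ ℓ) (p : PMF (Fin k)) (x : Fin k) :
    ((blockLaw ℓ p) (some x)).toReal = blockSuccess ℓ p * (p x).toReal := by
  classical
  obtain ⟨j, hx⟩ := exists_inPart hℓ x
  -- The two possible senders of `x`, one for each value of `h`, give disjoint events; their
  -- probabilities `p x / 2` add up and cancel the loss from flipping.
  have hind : ∀ w : BlockPlayer k ℓ → Message ℓ,
      (if some x = blockOutcome w then (1 : ℝ) else 0) =
        ∑ h : Fin 2, if ∀ t, Compatible x (h, j) t (w t) then (1 : ℝ) else 0 := fun w => by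
    rw [if_congr ((blockOutcome_eq_some_iff hℓ w x).trans (produces_iff hℓ hx w)) rfl rfl]
    split_ifs with hw
    · obtain ⟨h, hc⟩ := hw
      rw [Finset.sum_eq_single h, if_pos hc]
      · intro h' _ hne
        exact if_neg fun hc' => hne (compatible_unique hℓ hc' hc)
      · exact fun hh => absurd (Finset.mem_univ h) hh
    · exact (Finset.sum_eq_zero fun h _ => if_neg fun hc => hw ⟨h, hc⟩).symm
  have hprod : ∀ h : Fin 2, ∑ w : BlockPlayer k ℓ → Message ℓ,
      (∏ t, ((flippedLaw ℓ p t.2.1) (w t)).toReal) *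
        (if ∀ t, Compatible x (h, j) t (w t) then (1 : ℝ) else 0) =
      blockSuccess ℓ p * ((p x).toReal / 2) := fun h => by
    have e : ∀ w : BlockPlayer k ℓ → Message ℓ,
        (∏ t, ((flippedLaw ℓ p t.2.1) (w t)).toReal) *
          (if ∀ t, Compatible x (h, j) t (w t) then (1 : ℝ) else 0) =
        ∏ t, if Compatible x (h, j) t (w t) then
          ((flippedLaw ℓ p t.2.1) (w t)).toReal else 0 := fun w => by
      split_ifs with hc
      · rw [mul_one]
        exact Finset.prod_congr rfl fun t _ => (if_pos (hc t)).symm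
      · obtain ⟨t, ht⟩ := not_forall.mp hc
        rw [mul_zero]
        exact (Finset.prod_eq_zero (Finset.mem_univ t) (if_neg ht)).symm
    simp only [e]
    have hp := Finset.prod_univ_sum (fun _ : BlockPlayer k ℓ => (Finset.univ : Finset (Message ℓ)))
      (fun t m => if Compatible x (h, j) t m then ((flippedLaw ℓ p t.2.1) m).toReal else 0)
    rw [Fintype.piFinset_univ] at hp
    rw [← hp, Fintype.prod_prod_type]
    simp only [Fintype.prod_prod_type (fun y : Fin (numParts k ℓ) × Fin 2 => _)]
    simp only [sum_compatible hℓ p hx, Finset.prod_mul_distrib]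
    rw [← Fintype.prod_prod_type' (fun a b =>
      if (a, b) = (h, j) then (p x).toReal / 2 else 1)]
    simp [blockSuccess]
  rw [blockLaw, toReal_bind_apply]
  simp only [indepLaw_apply, ENNReal.toReal_prod, toReal_pure_apply, hind, Finset.mul_sum]
  rw [Finset.sum_comm]
  simp only [hprod, Fin.sum_univ_two]
  ring

theorem toReal_blockLaw_none (hℓ : 1 ≤ ℓ) (p : PMF (Fin k)) :
    ((blockLaw ℓ p) none).toReal = 1 - blockSuccess ℓ p := by
  have h := sum_toReal_eq_one (blockLaw ℓ p)
  rw [Fintype.sum_option] at h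
  simp only [toReal_blockLaw_some hℓ, ← Finset.mul_sum, sum_toReal_eq_one] at h
  linarith

theorem activeProb_nonneg (p : PMF (Fin k)) (j : Fin (numParts k ℓ)) : 0 ≤ activeProb ℓ p j :=
  Finset.sum_nonneg fun x _ => by split_ifs <;> positivity

theorem sum_activeProb (hℓ : 1 ≤ ℓ) (p : PMF (Fin k)) : ∑ j, activeProb ℓ p j = 1 / 2 := by
  classical
  simp only [activeProb]
  rw [Finset.sum_comm]
  have h : ∀ x, (∑ j : Fin (numParts k ℓ), if InPart ℓ x j then (p x).toReal / 2 else 0) =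
      (p x).toReal / 2 := fun x => by
    obtain ⟨j, hj⟩ := exists_inPart hℓ x
    rw [Finset.sum_eq_single j, if_pos hj]
    · intro j' _ hne
      exact if_neg fun h => hne (Fin.ext (h.symm.trans hj))
    · exact fun hh => absurd (Finset.mem_univ j) hh
  simp only [h, ← Finset.sum_div, sum_toReal_eq_one]

/-- Flipping makes the total activity `1 / 2`, so the union bound leaves `1 - 1 / 2` for each half
of the block, whatever `p` is. -/
theorem blockSuccess_mem (hℓ : 1 ≤ ℓ) (p : PMF (Fin k)) :
    1 / 4 ≤ blockSuccess ℓ p ∧ blockSuccess ℓ p ≤ 1 := by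
  have hle : ∀ j, activeProb ℓ p j ≤ 1 / 2 := fun j => sum_activeProb hℓ p ▸
    Finset.single_le_sum (fun i _ => activeProb_nonneg p i) (Finset.mem_univ j)
  have h1 : 1 - ∑ j, activeProb ℓ p j ≤ ∏ j, (1 - activeProb ℓ p j) := by
    have key := prod_add_sum_mul_prod_erase_le Finset.univ (a := fun _ => (1 : ℝ))
      (d := fun _ => -1) (w := activeProb ℓ p) (fun _ => zero_le_one) (activeProb_nonneg p)
      (fun j => by have := hle j; linarith) (Or.inr fun _ => by norm_num)
    simpa [sub_eq_add_neg] using key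
  rw [sum_activeProb hℓ] at h1
  have h2 : ∏ j, (1 - activeProb ℓ p j) ≤ 1 :=
    Finset.prod_le_one (fun j _ => by have := hle j; linarith)
      fun j _ => by have := activeProb_nonneg p j; linarith
  constructor <;> rw [blockSuccess] <;> nlinarith

/-! ### The output of simulate-and-infer -/

/-- The decision from the outcomes of the blocks. -/
def inferOutcomes {N : ℕ} (e : (Fin N → Fin k) → PMF Bool) (d : Bool)
    (o : List (Option (Fin k))) : PMF Bool :=
  if h : N ≤ o.reduceOption.length then
    e fun i => o.reduceOption.get ⟨i, lt_of_lt_of_le i.isLt h⟩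
  else PMF.pure d

theorem toReal_output_simulateAndInfer {B N : ℕ} (e : (Fin N → Fin k) → PMF Bool) (d v : Bool)
    (p : PMF (Fin k)) :
    (((simulateAndInfer k ℓ B e d).output p) v).toReal =
      listMean (fun o => ((blockLaw ℓ p) o).toReal) B
        (fun o => ((inferOutcomes e d o) v).toReal) := by
  have h : (simulateAndInfer k ℓ B e d).output p =
      (indepLaw fun t : Fin B × BlockPlayer k ℓ => flippedLaw ℓ p t.2.2.1).bind
        (inferFrom e d) := by
    have h1 : (simulateAndInfer k ℓ B e d).comm.messages p =
        indepLaw fun t => p.bind fun x => PMF.pure (playerMessage ℓ t.2.2.1 x) := by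
      rw [← indepLaw_bind_indepLaw]
      simp only [PrivateCoinSMP.messages, iidLaw]
      congr 1
      funext X
      simp only [PrivateCoinSMP.messagesGiven, simulateAndInfer, PMF.pure_bind]
    rw [PrivateCoinTester.output, h1]
    simp only [simulateAndInfer]
    rw [← PMF.bind_bind, indepLaw_bind_indepLaw (fun t : SIPlayer k ℓ B =>
      p.bind fun x => PMF.pure (playerMessage ℓ t.2.2.1 x)) (fun _ => flipMessage)]
    simp only [PMF.bind_bind, PMF.pure_bind, flippedLaw]
  have h2 : (inferFrom e d : (SIPlayer k ℓ B → Message ℓ) → PMF Bool) =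
      fun w => inferOutcomes e d (List.ofFn fun b => blockOutcome fun t => w (b, t)) := rfl
  rw [h, h2, indepLaw_prod_bind (fun t : BlockPlayer k ℓ => flippedLaw ℓ p t.2.1) blockOutcome
    (fun o => inferOutcomes e d (List.ofFn o))]
  exact toReal_iidLaw_bind_apply _ _ _ _ _ fun _ => rfl

/-- The probability that `e` decides `v` on a list of `N` samples. -/
def decisionProb {N : ℕ} (e : (Fin N → Fin k) → PMF Bool) (v : Bool) (l : List (Fin k)) : ℝ :=
  if h : l.length = N then ((e fun i => l.get (i.cast h.symm)) v).toReal else 0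

/-- Runs with too few samples are counted as failures, which makes the bound valid for either
default decision `d`. -/
theorem atLeastProb_mul_le_output (hℓ : 1 ≤ ℓ) {B N : ℕ} (e : (Fin N → Fin k) → PMF Bool)
    (d v : Bool) (p : PMF (Fin k)) :
    atLeastProb (blockSuccess ℓ p) B N * (((iidLaw p (Fin N)).bind e) v).toReal ≤
      (((simulateAndInfer k ℓ B e d).output p) v).toReal := by
  rw [toReal_iidLaw_bind_apply p N e v (decisionProb e v) fun f => by
      rw [decisionProb, dif_pos (List.length_ofFn)]
      congr 3
      funext i
      simp,
    ← listMean_prefixValue_reduceOption (ν := fun o => ((blockLaw ℓ p) o).toReal)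
      (fun x => toReal_blockLaw_some hℓ p x)
      (toReal_blockLaw_none hℓ p) (sum_toReal_eq_one p), toReal_output_simulateAndInfer]
  refine listMean_mono (fun _ => ENNReal.toReal_nonneg) fun o _ => ?_
  rw [prefixValue, inferOutcomes]
  by_cases h : N ≤ o.reduceOption.length
  · rw [if_pos h, dif_pos h, decisionProb, dif_pos (by simp [h])]
    refine le_of_eq ?_
    congr 3
    funext i
    simp
  · rw [if_neg h, dif_neg h]
    exact ENNReal.toReal_nonneg

theorem simulateAndInfer_isDeterministic {B N : ℕ} (e : (Fin N → Fin k) → PMF Bool) (d : Bool) :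
    (simulateAndInfer k ℓ B e d).comm.IsDeterministic :=
  fun t => ⟨playerMessage ℓ t.2.2.1, fun _ _ _ => rfl⟩

end Block

/-! ### Parameters -/

theorem one_lt_of_one_le_ceil_logb {k ℓ : ℕ} (hℓ : 1 ≤ ℓ) (hk : ℓ ≤ ⌈Real.logb 2 (k : ℝ)⌉₊) :
    1 < k := by
  by_contra h
  have hl : Real.logb 2 (k : ℝ) = 0 := by
    interval_cases k <;> simp
  rw [hl, Nat.ceil_zero] at hk
  omega

theorem two_pow_le_of_le_ceil_logb {k ℓ : ℕ} (hk1 : 1 < k)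
    (hk : ℓ ≤ ⌈Real.logb 2 (k : ℝ)⌉₊) : 2 ^ ℓ ≤ 2 * k := by
  have hkp : (1 : ℝ) < k := by exact_mod_cast hk1
  have h1 : (ℓ : ℝ) ≤ Real.logb 2 k + 1 :=
    (Nat.cast_le.mpr hk).trans (Nat.ceil_lt_add_one
      (Real.logb_nonneg (by norm_num) hkp.le)).le
  have h2 : (2 : ℝ) ^ (ℓ : ℝ) ≤ 2 ^ (Real.logb 2 k + 1) :=
    Real.rpow_le_rpow_of_exponent_le (by norm_num) h1
  rw [Real.rpow_add (by norm_num), Real.rpow_logb (by norm_num) (by norm_num) (by linarith),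
    Real.rpow_natCast, Real.rpow_one, mul_comm] at h2
  exact_mod_cast h2

theorem numParts_mul_two_pow_le {k ℓ : ℕ} (hℓ : 1 ≤ ℓ) (h : 2 ^ ℓ ≤ 2 * k) :
    numParts k ℓ * 2 ^ ℓ ≤ 6 * k := by
  have hM := one_le_partSize hℓ
  rw [numParts, Nat.ceilDiv_eq_add_pred_div]
  have h1 := Nat.div_mul_le_self (k + (2 ^ ℓ - 1) - 1) (2 ^ ℓ - 1)
  generalize (k + (2 ^ ℓ - 1) - 1) / (2 ^ ℓ - 1) = m at *
  have h2 : 2 ^ ℓ ≤ 2 * (2 ^ ℓ - 1) := by omega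
  calc m * 2 ^ ℓ ≤ m * (2 * (2 ^ ℓ - 1)) := Nat.mul_le_mul_left m h2
    _ = 2 * (m * (2 ^ ℓ - 1)) := by ring
    _ ≤ 6 * k := by omega

theorem card_SIPlayer (k ℓ B : ℕ) : Fintype.card (SIPlayer k ℓ B) = 4 * B * numParts k ℓ := by
  simp only [Fintype.card_prod, Fintype.card_fin]
  ring

theorem tvDist_le_one {k : ℕ} (p q : PMF (Fin k)) : tvDist p q ≤ 1 := by
  rw [tvDist_eq_sum_max, ← sum_toReal_eq_one q]
  exact Finset.sum_le_sum fun x _ => max_le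
    (by linarith [(ENNReal.toReal_nonneg : 0 ≤ (p x).toReal)]) ENNReal.toReal_nonneg

theorem exists_test {k : ℕ} (hk : 1 ≤ k) {ε L : ℝ} (hε : 0 < ε) (hε1 : ε ≤ 1) (hL : 1 ≤ L) :
    ∃ N : ℕ, (N : ℝ) ≤ (2 ^ 15 * (Real.sqrt (k * L) + 17 * L) + 2) / ε ^ 2 ∧
      ∀ q : PMF (Fin k), ∃ e : (Fin N → Fin k) → PMF Bool,
        1 - Real.exp (-L) ≤ (((iidLaw q (Fin N)).bind e) true).toReal ∧
        ∀ p : PMF (Fin k), ε < tvDist p q →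
          1 - Real.exp (-L) ≤ (((iidLaw p (Fin N)).bind e) false).toReal := by
  have hε2 : 0 < ε ^ 2 := by positivity
  have hε21 : ε ^ 2 ≤ 1 := pow_le_one₀ hε.le hε1
  have hinv : 1 ≤ 1 / ε ^ 2 := by rwa [le_div_iff₀ hε2, one_mul]
  -- The padding by `256 * L` gives `√(K * L) ≤ K / 16`. Then `N / K` stays below the cap `r`, which
  -- is itself limited by `ε ^ 2 * r ≤ 2 ^ 12`.
  set K : ℕ := k + ⌈256 * L⌉₊ with hK
  have hKL : 256 * L ≤ K := by
    have := Nat.le_ceil (256 * L); rw [hK]; push_cast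
    linarith [(Nat.cast_nonneg k : (0 : ℝ) ≤ k)]
  have hKu : (K : ℝ) ≤ k + 257 * L := by
    have := (Nat.ceil_lt_add_one (by linarith : 0 ≤ 256 * L)).le; rw [hK]; push_cast; linarith
  have hKp : (0 : ℝ) < K := by linarith
  set s : ℝ := Real.sqrt (K * L) with hs
  have hs0 : 0 ≤ s := Real.sqrt_nonneg _
  have hs2 : s ^ 2 = K * L := Real.sq_sqrt (by positivity)
  set M : ℕ := ⌈2 ^ 14 * s / ε ^ 2⌉₊ with hM
  have hM1 : 2 ^ 14 * s / ε ^ 2 ≤ M := Nat.le_ceil _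
  have hM2 : (M : ℝ) ≤ 2 ^ 14 * s / ε ^ 2 + 1 := (Nat.ceil_lt_add_one (by positivity)).le
  set r : ℕ := ⌊2 ^ 12 / ε ^ 2⌋₊ with hr
  have hr1 : (r : ℝ) ≤ 2 ^ 12 / ε ^ 2 := Nat.floor_le (by positivity)
  have hr2 : 2 ^ 12 / ε ^ 2 - 1 ≤ (r : ℝ) := (Nat.sub_one_lt_floor _).le
  refine ⟨M + M, ?_, fun q => exists_test_of_sampleSize q (K := K) (r := r) (by omega) (by omega)
    hε hε1 ?_ ?_ ?_ ?_⟩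
  · have h1 : s ≤ Real.sqrt (k * L) + 17 * L := by
      have hq := Real.sqrt_nonneg ((k : ℝ) * L)
      refine Real.sqrt_le_iff.mpr ⟨by positivity, ?_⟩
      have h2 : Real.sqrt (k * L) ^ 2 = k * L := Real.sq_sqrt (by positivity)
      nlinarith [mul_le_mul_of_nonneg_right hKu (by linarith : 0 ≤ L),
        mul_nonneg hq (by linarith : 0 ≤ L)]
    have h3 : 2 ^ 14 * s / ε ^ 2 ≤ 2 ^ 14 * (Real.sqrt (k * L) + 17 * L) / ε ^ 2 := by gcongr
    push_cast
    rw [add_div]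
    have e1 : 2 ^ 15 * (Real.sqrt (k * L) + 17 * L) / ε ^ 2 =
        2 * (2 ^ 14 * (Real.sqrt (k * L) + 17 * L) / ε ^ 2) := by ring
    have e2 : 2 / ε ^ 2 = 2 * (1 / ε ^ 2) := by ring
    rw [e1, e2]
    linarith
  · rw [hr, Nat.one_le_floor_iff, le_div_iff₀ hε2]
    linarith
  · rw [mul_comm]
    exact (le_div_iff₀ hε2).mp hr1
  · have h1 : s ≤ K / 16 := by
      refine Real.sqrt_le_iff.mpr ⟨by positivity, ?_⟩
      nlinarith [mul_le_mul_of_nonneg_left hKL hKp.le]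
    rw [div_le_iff₀ hKp]
    have h2 : 2 ^ 14 * s / ε ^ 2 ≤ 2 ^ 10 * (1 / ε ^ 2) * K := by
      calc 2 ^ 14 * s / ε ^ 2 ≤ 2 ^ 14 * (K / 16) / ε ^ 2 := by gcongr
        _ = _ := by ring
    have h3 : (2 : ℝ) ^ 12 / ε ^ 2 = 2 ^ 12 * (1 / ε ^ 2) := by ring
    rw [h3] at hr2
    have h4 : (1 : ℝ) ≤ K := by linarith
    have h5 := mul_le_mul_of_nonneg_right hr2 hKp.le
    have h6 := mul_le_mul_of_nonneg_right hinv hKp.le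
    nlinarith
  · have h1 : 2 ^ 14 * s ≤ M * ε ^ 2 := (div_le_iff₀ hε2).mp hM1
    have h2 : (2 ^ 14 * s) ^ 2 ≤ (M * ε ^ 2) ^ 2 := pow_le_pow_left₀ (by positivity) h1 2
    push_cast
    nlinarith

/-- As `1 - A / 2 ≤ 7 / 8 ≤ exp (-1 / 8)`, eight blocks per sample absorb the factor `2 ^ N ≤ exp
N`, and `8 * M` more leave `exp (-M)`. -/
theorem le_atLeastProb_of_blocks {A L : ℝ} (hA : 1 / 4 ≤ A) (hA1 : A ≤ 1) {N M : ℕ} (hM : L ≤ M) :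
    1 - Real.exp (-L) ≤ atLeastProb A (8 * (N + M)) N := by
  refine le_trans (sub_le_sub_left ?_ 1) (le_atLeastProb (by linarith) hA1 _ _)
  have h1 : (1 - A / 2) ^ (8 * (N + M)) ≤ Real.exp (-(1 / 8)) ^ (8 * (N + M)) := by
    refine pow_le_pow_left₀ (by linarith) ?_ _
    have := Real.add_one_le_exp (-(1 / 8 : ℝ))
    linarith
  have h2 : (2 : ℝ) ^ N ≤ Real.exp 1 ^ N := by
    refine pow_le_pow_left₀ (by norm_num) ?_ _
    have := Real.add_one_le_exp (1 : ℝ)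
    linarith
  calc (2 : ℝ) ^ N * (1 - A / 2) ^ (8 * (N + M))
      ≤ Real.exp 1 ^ N * Real.exp (-(1 / 8)) ^ (8 * (N + M)) :=
        mul_le_mul h2 h1 (pow_nonneg (by linarith) _) (by positivity)
    _ = Real.exp (-M) := by
        rw [← Real.exp_nat_mul, ← Real.exp_nat_mul, ← Real.exp_add]
        congr 1
        push_cast
        ring
    _ ≤ Real.exp (-L) := Real.exp_le_exp.mpr (neg_le_neg hM)

/-! ### Simulate-and-infer tests identity -/

/-- Degenerate parameters: with `B = N = 0` the requirement of `N` samples holds vacuously, and the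
referee just draws from `m`. -/
theorem simulateAndInferTestsIdentity_zero {k ℓ : ℕ} (hℓ : 1 ≤ ℓ) {ε δ : ℝ} (m : PMF Bool)
    (h1 : 1 - δ < (m true).toReal)
    (h2 : ∀ p q : PMF (Fin k), ε < tvDist p q → 1 - δ < (m false).toReal) :
    SimulateAndInferTestsIdentity k ℓ ε δ 0 := by
  have hb : ∀ p : PMF (Fin k), (iidLaw p (Fin 0)).bind (fun _ => m) = m := fun p =>
    PMF.bind_const _ _
  have ho : ∀ (p : PMF (Fin k)) (d v : Bool), (m v).toReal ≤
      (((simulateAndInfer k ℓ 0 (N := 0) (fun _ => m) d).output p) v).toReal := fun p d v => by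
    have := atLeastProb_mul_le_output hℓ (B := 0) (N := 0) (fun _ => m) d v p
    rwa [hb, atLeastProb, one_mul] at this
  refine ⟨0, 0, by rw [card_SIPlayer]; simp, fun q => ⟨fun _ => m, ⟨?_, fun p hp => ?_⟩,
    fun d => ⟨simulateAndInfer_isDeterministic _ _, h1.trans_le (ho _ _ _),
      fun p hp => (h2 p q hp).trans_le (ho _ _ _)⟩⟩⟩
  · rwa [hb]
  · rw [hb]; exact h2 p q hp

theorem exists_simulateAndInferTestsIdentity_of_lt_one {k ℓ : ℕ} {ε δ : ℝ} (hℓ : 1 ≤ ℓ)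
    (hk : ℓ ≤ ⌈Real.logb 2 (k : ℝ)⌉₊) (hε : 0 < ε) (hε1 : ε < 1) (hδ : 0 < δ)
    (hδ2 : δ ≤ 1 / 2) :
    ∃ n : ℕ, SimulateAndInferTestsIdentity k ℓ ε δ n ∧
      (n : ℝ) ≤ 2 ^ 30 * ((k : ℝ) / (2 ^ ℓ * ε ^ 2) *
        (Real.sqrt ((k : ℝ) * Real.logb 2 (1 / δ)) + Real.logb 2 (1 / δ))) := by
  have hk1 := one_lt_of_one_le_ceil_logb hℓ hk
  have h2k := two_pow_le_of_le_ceil_logb hk1 hk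
  set Λ : ℝ := Real.logb 2 (1 / δ) with hΛ
  have hΛ1 : 1 ≤ Λ := by
    rw [hΛ, Real.le_logb_iff_rpow_le (by norm_num) (by positivity), Real.rpow_one,
      le_div_iff₀ hδ]
    linarith
  -- Simulation and test may each fail with probability `δ / 4`; together this keeps the error
  -- strictly below `δ`.
  set L : ℝ := Real.log (4 / δ) with hLdef
  have hLΛ : L = (2 + Λ) * Real.log 2 := by
    have e : (4 : ℝ) / δ = 2 ^ 2 * (1 / δ) := by ring
    rw [hLdef, e, Real.log_mul (by positivity) (by positivity), Real.log_pow, hΛ, Real.logb]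
    have := Real.log_pos (by norm_num : (1 : ℝ) < 2)
    field_simp
    push_cast
    ring
  have hl1 := Real.log_two_gt_d9
  have hl2 := Real.log_two_lt_d9
  have hL1 : 1 ≤ L := by rw [hLΛ]; nlinarith
  have hL3 : L ≤ 3 * Λ := by rw [hLΛ]; nlinarith
  have hexp : Real.exp (-L) = δ / 4 := by
    rw [Real.exp_neg, hLdef, Real.exp_log (by positivity), inv_div]
  obtain ⟨N, hN, htest⟩ := exists_test hk1.le hε hε1.le hL1
  set M : ℕ := ⌈L⌉₊ with hM
  have hprob : ∀ p : PMF (Fin k), 1 - δ / 4 ≤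
      atLeastProb (blockSuccess ℓ p) (8 * (N + M)) N := fun p => by
    have := le_atLeastProb_of_blocks (blockSuccess_mem hℓ p).1 (blockSuccess_mem hℓ p).2
      (N := N) (Nat.le_ceil L)
    rwa [hexp] at this
  refine ⟨_, ⟨8 * (N + M), N, rfl, fun q => ?_⟩, ?_⟩
  · obtain ⟨e, he1, he2⟩ := htest q
    rw [hexp] at he1
    simp only [hexp] at he2
    have hout : ∀ (p : PMF (Fin k)) (d v : Bool),
        1 - δ / 4 ≤ (((iidLaw p (Fin N)).bind e) v).toReal →
        1 - δ < (((simulateAndInfer k ℓ (8 * (N + M)) e d).output p) v).toReal :=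
      fun p d v h => by
        refine lt_of_lt_of_le ?_ (atLeastProb_mul_le_output hℓ e d v p)
        have := mul_le_mul (hprob p) h (by linarith) (by linarith [hprob p])
        nlinarith
    exact ⟨e, ⟨by linarith, fun p hp => by linarith [he2 p hp]⟩, fun d =>
      ⟨simulateAndInfer_isDeterministic e d, hout q d true he1,
        fun p hp => hout p d false (he2 p hp)⟩⟩
  · rw [card_SIPlayer]
    have hε2 : 0 < ε ^ 2 := by positivity
    have hε21 : ε ^ 2 ≤ 1 := pow_le_one₀ hε.le hε1.le
    set s : ℝ := Real.sqrt (k * Λ) with hs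
    have hs0 : 0 ≤ s := Real.sqrt_nonneg _
    have hsL : Real.sqrt (k * L) ≤ 2 * s := by
      refine Real.sqrt_le_iff.mpr ⟨by positivity, ?_⟩
      rw [mul_pow, hs, Real.sq_sqrt (by positivity)]
      nlinarith [mul_le_mul_of_nonneg_left hL3 (Nat.cast_nonneg (α := ℝ) k),
        mul_nonneg (Nat.cast_nonneg (α := ℝ) k) (by linarith : 0 ≤ Λ)]
    have hMu : (M : ℝ) ≤ 4 * Λ / ε ^ 2 := by
      have h1 : (M : ℝ) ≤ 4 * Λ := by
        have := (Nat.ceil_lt_add_one (by linarith : 0 ≤ L)).le; linarith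
      rw [le_div_iff₀ hε2]
      nlinarith [(Nat.cast_nonneg M : (0 : ℝ) ≤ M)]
    have hB : ((8 * (N + M) : ℕ) : ℝ) ≤ 2 ^ 25 * (s + Λ) / ε ^ 2 := by
      push_cast
      rw [le_div_iff₀ hε2]
      rw [le_div_iff₀ hε2] at hN hMu
      nlinarith
    have hm : (numParts k ℓ : ℝ) ≤ 6 * k / 2 ^ ℓ := by
      rw [le_div_iff₀ (by positivity)]
      exact_mod_cast numParts_mul_two_pow_le hℓ h2k
    calc ((4 * (8 * (N + M)) * numParts k ℓ : ℕ) : ℝ)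
        = 4 * (8 * (N + M) : ℕ) * numParts k ℓ := by push_cast; ring
      _ ≤ 4 * (2 ^ 25 * (s + Λ) / ε ^ 2) * (6 * k / 2 ^ ℓ) := by gcongr
      _ = 24 * 2 ^ 25 * (k / (2 ^ ℓ * ε ^ 2) * (s + Λ)) := by
          field_simp
          norm_num
      _ ≤ 2 ^ 30 * (k / (2 ^ ℓ * ε ^ 2) * (s + Λ)) :=
        mul_le_mul_of_nonneg_right (by norm_num) (by positivity)

theorem exists_simulateAndInferTestsIdentity {k ℓ : ℕ} {ε δ : ℝ} (hℓ : 1 ≤ ℓ)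
    (hk : ℓ ≤ ⌈Real.logb 2 (k : ℝ)⌉₊) (hε : 0 < ε) (hδ : 0 < δ) (hδ1 : δ ≤ 1) :
    ∃ n : ℕ, SimulateAndInferTestsIdentity k ℓ ε δ n ∧
      (n : ℝ) ≤ 2 ^ 30 * ((k : ℝ) / (2 ^ ℓ * ε ^ 2) *
        (Real.sqrt ((k : ℝ) * Real.logb 2 (1 / δ)) + Real.logb 2 (1 / δ))) := by
  have hlog : 0 ≤ Real.logb 2 (1 / δ) :=
    Real.logb_nonneg (by norm_num) (by rwa [le_div_iff₀ hδ, one_mul])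
  -- For `ε ≥ 1` no law is far from `q`, so constant acceptance works. For `δ > 1 / 2` a fair coin
  -- works, which matters because `log (1 / δ)` may then be arbitrarily small. Otherwise `log (1 /
  -- δ) ≥ 1` absorbs all additive constants.
  rcases le_or_gt 1 ε with hε1 | hε1
  · refine ⟨0, simulateAndInferTestsIdentity_zero hℓ (PMF.pure true) ?_ fun p q h =>
      absurd h (not_lt.mpr ((tvDist_le_one p q).trans hε1)), by rw [Nat.cast_zero]; positivity⟩
    rw [toReal_pure_apply, if_pos rfl]
    linarith
  rcases le_or_gt δ (1 / 2) with hδ2 | hδ2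
  · exact exists_simulateAndInferTestsIdentity_of_lt_one hℓ hk hε hε1 hδ hδ2
  · have h : ∀ v, 1 - δ < ((PMF.uniformOfFintype Bool) v).toReal := fun v => by
      rw [toReal_uniformOfFintype_apply, Fintype.card_bool]
      push_cast
      linarith
    exact ⟨0, simulateAndInferTestsIdentity_zero hℓ (PMF.uniformOfFintype Bool) (h true)
      fun _ _ _ => h false, by rw [Nat.cast_zero]; positivity⟩

end

theorem mainTheorem8 :
    (∃ C : ℝ, ∀ (k ℓ : ℕ) (ε δ : ℝ), 1 ≤ ℓ → ℓ ≤ ⌈Real.logb 2 (k : ℝ)⌉₊ →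
      0 < ε → 0 < δ → δ ≤ 1 →
      ∃ n : ℕ, SimulateAndInferTestsIdentity k ℓ ε δ n ∧
        (n : ℝ) ≤ C * ((k : ℝ) / (2 ^ ℓ * ε ^ 2) *
          (Real.sqrt ((k : ℝ) * Real.logb 2 (1 / δ)) + Real.logb 2 (1 / δ)))) ∧
    (∀ δ : ℝ, 0 < δ → δ ≤ 1 →
      ∃ C : ℝ, ∀ (k ℓ : ℕ) (ε : ℝ), 1 ≤ ℓ → ℓ ≤ ⌈Real.logb 2 (k : ℝ)⌉₊ →
      0 < ε →
      ∃ n : ℕ, SimulateAndInferTestsIdentity k ℓ ε δ n ∧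
        (n : ℝ) ≤ C * ((k : ℝ) ^ (3 / 2 : ℝ) / (2 ^ ℓ * ε ^ 2))) := by
  refine ⟨⟨2 ^ 30, fun k ℓ ε δ hℓ hk hε hδ hδ1 =>
    exists_simulateAndInferTestsIdentity hℓ hk hε hδ hδ1⟩, fun δ hδ hδ1 =>
    ⟨2 ^ 30 * (Real.sqrt (Real.logb 2 (1 / δ)) + Real.logb 2 (1 / δ)), fun k ℓ ε hℓ hk hε => ?_⟩⟩
  obtain ⟨n, hn, hle⟩ := exists_simulateAndInferTestsIdentity hℓ hk hε hδ hδ1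
  refine ⟨n, hn, hle.trans ?_⟩
  have hk1 : (1 : ℝ) ≤ k := by exact_mod_cast (one_lt_of_one_le_ceil_logb hℓ hk).le
  have hlog : 0 ≤ Real.logb 2 (1 / δ) :=
    Real.logb_nonneg (by norm_num) (by rwa [le_div_iff₀ hδ, one_mul])
  have e : (k : ℝ) ^ (3 / 2 : ℝ) = k * Real.sqrt k := by
    rw [show (3 / 2 : ℝ) = 1 + 1 / 2 by norm_num, Real.rpow_add (by linarith), Real.rpow_one,
      Real.sqrt_eq_rpow]
  rw [e, Real.sqrt_mul (by linarith)]
  have hsk : 1 ≤ Real.sqrt k := Real.one_le_sqrt.mpr hk1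
  calc 2 ^ 30 * ((k : ℝ) / (2 ^ ℓ * ε ^ 2) *
        (Real.sqrt k * Real.sqrt (Real.logb 2 (1 / δ)) + Real.logb 2 (1 / δ)))
      ≤ 2 ^ 30 * ((k : ℝ) / (2 ^ ℓ * ε ^ 2) *
        (Real.sqrt k * Real.sqrt (Real.logb 2 (1 / δ)) +
          Real.sqrt k * Real.logb 2 (1 / δ))) := by
        gcongr
        exact le_mul_of_one_le_left hlog hsk
    _ = _ := by ring
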